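/- Let $G$ be the free group on two generators $x,y$, and put $z=x^{-1}y^{-1}xy\in G$. Let $M_0$ be the submonoid of $G$ generated by $x,y,z$, and $M_1$ the submonoid of $G$ generated by $x,y,z,z^{-1}$. Let $\sigma$ be the automorphism of $G$ with $\sigma(x)=yx$ and $\sigma(y)=yxy$; it fixes $z$, hence carries $M_0$ and $M_1$ into themselves. For $i=0,1$ let $M_{(i)}$ be the submonoid of all $a\in G$ such that $\sigma^n(a)\in M_i$ for some $n\ge 0$. Let $D$ be any division ring, let $M=M_{(0)}$ or $M=M_{(1)}$, and let $DM$ be the monoid ring, in which elements of $D$ commute with elements of $M$. Let $\delta:G\to\mathbb{Z}\times\mathbb{Z}$ be the homomorphism with $\delta(x)=(1,0)$ and $\delta(y)=(0,1)$, and let $h:\mathbb{Z}\times\mathbb{Z}\to\mathbb{Z}$ be any nonzero homomorphism. Give $DM$ the $\mathbb{Z}$-grading whose component $DM_\alpha$ of degree $\alpha\in\mathbb{Z}$ is the $D$-span of $\{c\in M : h(\delta(c))=\alpha\}$. Then $DM$ is an $h\delta$-homogeneous semifir; that is, every homogeneous linear relation in $DM$ can be homogeneously trivialized: for every $m$, all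 $\alpha_1,\dots,\alpha_m,\beta\in\mathbb{Z}$, and all $u_i\in DM_{\alpha_i}$ and $v_i\in DM_{-\alpha_i+\beta}$ $(1\le i\le m)$ with $\sum_{i=1}^m u_iv_i=0$, there is an invertible $m\times m$ matrix $T=(T_{ij})$ over $DM$, with $T_{ij}\in DM_{-\alpha_i+\alpha_j}$ for all $i,j$, such that, writing $(u'_i)=(u_i)T$ (row vectors) and $(v'_i)=T^{-1}(v_i)$ (column vectors), for each $i$ either $u'_i=0$ or $v'_i=0$. -/

import Mathlib

/-! ### Linear relations in graded rings -/

namespace GradedSemifir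

open Matrix

/-- The `m`-term linear relation `∑ uᵢ vᵢ = 0` is trivial if for each `i`,
either `uᵢ = 0` or `vᵢ = 0`. -/
def IsTrivial {R : Type*} [Ring R] {m : ℕ} (u v : Fin m → R) : Prop :=
  ∀ i, u i = 0 ∨ v i = 0

/-- The invertible matrix `T` trivializes the linear relation `(uᵢ) · (vᵢ) = 0` if
the relation `((uᵢ) T) · (T⁻¹ (vᵢ)) = 0` is trivial. -/
def Trivializes {R : Type*} [Ring R] {m : ℕ} (T : (Matrix (Fin m) (Fin m) R)ˣ)
    (u v : Fin m → R) : Prop :=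
  IsTrivial (u ᵥ* (T : Matrix (Fin m) (Fin m) R))
    (((T⁻¹ : (Matrix (Fin m) (Fin m) R)ˣ) : Matrix (Fin m) (Fin m) R) *ᵥ v)

section

variable {A R S : Type*} [AddGroup A] [DecidableEq A] [Ring R]
  [SetLike S R] [AddSubmonoidClass S R]

/-- A homogeneous `m`-term linear relation `∑ uᵢ vᵢ = 0` in an `A`-graded ring, with
`uᵢ` of degree `αᵢ` and `vᵢ` of degree `-αᵢ + β`. -/
structure IsHomogeneousRelation (𝒜 : A → S) [GradedRing 𝒜] {m : ℕ}
    (α : Fin m → A) (β : A) (u v : Fin m → R) : Prop where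
  left_mem : ∀ i, u i ∈ 𝒜 (α i)
  right_mem : ∀ i, v i ∈ 𝒜 (-α i + β)
  sum_eq_zero : ∑ i, u i * v i = 0

/-- The graded ring is a homogeneous `n`-fir: every homogeneous linear relation of at most
`n` terms is trivialized by an invertible matrix `T` with `Tᵢⱼ` homogeneous of
degree `-αᵢ + αⱼ`. -/
def IsHomogeneousNFir (𝒜 : A → S) [GradedRing 𝒜] (n : ℕ) : Prop :=
  ∀ m : ℕ, m ≤ n → ∀ (α : Fin m → A) (β : A) (u v : Fin m → R),
    IsHomogeneousRelation 𝒜 α β u v →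
      ∃ T : (Matrix (Fin m) (Fin m) R)ˣ,
        (∀ i j, (T : Matrix (Fin m) (Fin m) R) i j ∈ 𝒜 (-α i + α j)) ∧ Trivializes T u v

/-- The graded ring is a homogeneous semifir: it is a homogeneous `n`-fir for all `n`. -/
def IsHomogeneousSemifir (𝒜 : A → S) [GradedRing 𝒜] : Prop :=
  ∀ n : ℕ, IsHomogeneousNFir 𝒜 n

end

/-! ### The grading of a monoid ring induced by a homomorphism to a group -/

section

variable (D : Type*) [Ring D] {M A : Type*} [Monoid M] [AddGroup A]

/-- The homogeneous component of degree `a` of the monoid ring `D M`, for the grading induced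
by a homomorphism `f` from `M` to the (additive) group `A`: the left `D`-span of
`{c ∈ M | f c = a}`. -/
noncomputable def component (f : M →* Multiplicative A) (a : A) : Submodule D (MonoidAlgebra D M) :=
  Submodule.span D ((fun c : M => MonoidAlgebra.single c (1 : D)) ''
    {c : M | (f c).toAdd = a})

variable {D}

theorem single_mem_component (f : M →* Multiplicative A) (c : M) (r : D) :
    MonoidAlgebra.single c r ∈ component D f (f c).toAdd := by
  have h : MonoidAlgebra.single c r = r • MonoidAlgebra.single c (1 : D) := by
    simp
  rw [h]
  exact Submodule.smul_mem _ _ (Submodule.subset_span ⟨c, rfl, rfl⟩)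

instance component_gradedMonoid (f : M →* Multiplicative A) :
    SetLike.GradedMonoid (component D f) where
  one_mem := by
    have h := single_mem_component (D := D) f 1 1
    rwa [map_one] at h
  mul_mem := by
    intro a b p q hp hq
    have key : ∀ c : M, (f c).toAdd = a → ∀ r : D,
        MonoidAlgebra.single c r * q ∈ component D f (a + b) := by
      intro c hc r
      induction hq using Submodule.span_induction generalizing r with
      | mem x hx =>
        obtain ⟨d, hd, rfl⟩ := hx
        have h := single_mem_component (D := D) f (c * d) (r * 1)
        rw [map_mul, toAdd_mul, hc, show (f d).toAdd = b from hd] at h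
        simpa [MonoidAlgebra.single_mul_single] using h
      | zero => simp
      | add x y _ _ hx hy => rw [mul_add]; exact add_mem (hx r) (hy r)
      | smul s x _ hx =>
        have h : MonoidAlgebra.single c r * s • x = MonoidAlgebra.single c (r * s) * x := by
          have h1 : s • x = MonoidAlgebra.single 1 s * x := by
            ext; simp [MonoidAlgebra.coeff_single_one_mul]
          rw [h1, ← mul_assoc, MonoidAlgebra.single_mul_single, mul_one]
        rw [h]
        exact hx (r * s)
    induction hp using Submodule.span_induction with
    | mem x hx =>
      obtain ⟨c, hc, rfl⟩ := hx
      exact key c hc 1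
    | zero => simp
    | add x y _ _ hx hy => rw [add_mul]; exact add_mem hx hy
    | smul s x _ hx => rw [smul_mul_assoc]; exact Submodule.smul_mem _ _ hx

variable [DecidableEq A]

/-- Decomposition of an element of the monoid ring into its homogeneous parts. -/
noncomputable def decomposeHom (f : M →* Multiplicative A) :
    MonoidAlgebra D M →+ DirectSum A (fun a => component D f a) :=
  (Finsupp.liftAddHom fun c : M =>
    (DirectSum.of (fun a => component D f a) (f c).toAdd).comp
      { toFun := fun r : D =>
          (⟨MonoidAlgebra.single c r, single_mem_component f c r⟩ :
            component D f (f c).toAdd)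
        map_zero' := by ext1; simp
        map_add' := fun r s => by ext1; simp [MonoidAlgebra.single_add] }).comp
    (MonoidAlgebra.coeffAddEquiv (R := D) (M := M)).toAddMonoidHom

theorem decomposeHom_single (f : M →* Multiplicative A) (c : M) (r : D) :
    decomposeHom f (MonoidAlgebra.single c r) =
      DirectSum.of (fun a => component D f a) (f c).toAdd
        ⟨MonoidAlgebra.single c r, single_mem_component f c r⟩ := by
  simp only [decomposeHom, AddMonoidHom.comp_apply, AddEquiv.coe_toAddMonoidHom,
    MonoidAlgebra.coeffAddEquiv_apply, MonoidAlgebra.coeff_single,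
    Finsupp.liftAddHom_apply_single]
  rfl

theorem decomposeHom_of_mem (f : M →* Multiplicative A) (a : A) (x : MonoidAlgebra D M)
    (hx : x ∈ component D f a) :
    decomposeHom f x = DirectSum.of (fun a => component D f a) a ⟨x, hx⟩ := by
  suffices key : ∀ r : D, decomposeHom f (r • x) =
      DirectSum.of (fun a => component D f a) a ⟨r • x, Submodule.smul_mem _ r hx⟩ by
    simpa using key 1
  induction hx using Submodule.span_induction with
  | mem x hx =>
    obtain ⟨c, rfl, rfl⟩ := hx
    intro r
    have h : r • MonoidAlgebra.single c (1 : D) = MonoidAlgebra.single c r := by simp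
    simp only [h]
    exact decomposeHom_single f c r
  | zero =>
    intro r
    simp only [smul_zero, map_zero]
    exact (map_zero _).symm
  | add x y hx hy ihx ihy =>
    intro r
    simp only [smul_add, map_add, ihx, ihy]
    rw [← map_add]
    rfl
  | smul s x hx ih =>
    intro r
    simp only [smul_smul, ih]

noncomputable instance component_gradedRing (f : M →* Multiplicative A) :
    GradedRing (component D f) where
  toGradedMonoid := component_gradedMonoid f
  toDecomposition := DirectSum.Decomposition.ofAddHom _ (decomposeHom f)
    (by
      ext c r
      simp [decomposeHom_single])
    (by
      refine DirectSum.addHom_ext' fun a => AddMonoidHom.ext fun x => ?_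
      simp only [AddMonoidHom.comp_apply, DirectSum.coeAddMonoidHom_of, AddMonoidHom.id_apply]
      exact decomposeHom_of_mem f a (x : MonoidAlgebra D M) x.2)

end

end GradedSemifir

/-! ### The monoids `M_(0)` and `M_(1)` -/

namespace Cedo

/-- The free group on two generators. -/
abbrev G : Type := FreeGroup (Fin 2)

/-- The first free generator. -/
def x : G := FreeGroup.of 0

/-- The second free generator. -/
def y : G := FreeGroup.of 1

/-- The element `z = x⁻¹ y⁻¹ x y`. -/
def z : G := x⁻¹ * y⁻¹ * x * y

/-- The automorphism `σ` of `G` given by `σ x = y x`, `σ y = y x y`. -/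
def σ : G ≃* G :=
  MonoidHom.toMulEquiv (FreeGroup.lift ![y * x, y * x * y])
    (FreeGroup.lift ![y⁻¹ * x * x, x⁻¹ * y])
    (by ext i; fin_cases i <;> simp [x, y, mul_assoc])
    (by ext i; fin_cases i <;> simp [x, y, mul_assoc])

theorem σ_x : σ x = y * x := by simp [σ, x]

theorem σ_y : σ y = y * x * y := by simp [σ, y]

theorem σ_z : σ z = z := by simp [z, σ_x, σ_y, mul_assoc]

/-- The submonoid of `G` generated by `x`, `y` and `z`. -/
def M₀ : Submonoid G := Submonoid.closure {x, y, z}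

/-- The submonoid of `G` generated by `x`, `y`, `z` and `z⁻¹`. -/
def M₁ : Submonoid G := Submonoid.closure {x, y, z, z⁻¹}

theorem σ_mem_M₀ {a : G} (ha : a ∈ M₀) : σ a ∈ M₀ := by
  have hx : x ∈ M₀ := Submonoid.subset_closure (by simp)
  have hy : y ∈ M₀ := Submonoid.subset_closure (by simp)
  have hz : z ∈ M₀ := Submonoid.subset_closure (by simp)
  suffices h : M₀ ≤ M₀.comap (σ : G →* G) from h ha
  refine Submonoid.closure_le.2 ?_
  rintro _ (rfl | rfl | rfl)
  · simpa [σ_x] using mul_mem hy hx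
  · simpa [σ_y] using mul_mem (mul_mem hy hx) hy
  · simpa [σ_z] using hz

theorem σ_mem_M₁ {a : G} (ha : a ∈ M₁) : σ a ∈ M₁ := by
  have hx : x ∈ M₁ := Submonoid.subset_closure (by simp)
  have hy : y ∈ M₁ := Submonoid.subset_closure (by simp)
  have hz : z ∈ M₁ := Submonoid.subset_closure (by simp)
  have hz' : z⁻¹ ∈ M₁ := Submonoid.subset_closure (by simp)
  suffices h : M₁ ≤ M₁.comap (σ : G →* G) from h ha
  refine Submonoid.closure_le.2 ?_
  rintro _ (rfl | rfl | rfl | rfl)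
  · simpa [σ_x] using mul_mem hy hx
  · simpa [σ_y] using mul_mem (mul_mem hy hx) hy
  · simpa [σ_z] using hz
  · simpa [σ_z] using hz'

theorem iterate_mem {N : Submonoid G} (hN : ∀ a ∈ N, σ a ∈ N) {a : G} {m n : ℕ}
    (hmn : m ≤ n) (ha : σ^[m] a ∈ N) : σ^[n] a ∈ N := by
  induction n, hmn using Nat.le_induction with
  | base => exact ha
  | succ n _ ih => rw [Function.iterate_succ_apply']; exact hN _ ih

/-- For a submonoid `N` of `G` carried into itself by `σ`, the submonoid of all `a ∈ G` such
that `σⁿ a ∈ N` for some `n`. -/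
def limitMonoid (N : Submonoid G) (hN : ∀ a ∈ N, σ a ∈ N) : Submonoid G where
  carrier := {a | ∃ n : ℕ, σ^[n] a ∈ N}
  one_mem' := ⟨0, N.one_mem⟩
  mul_mem' := by
    rintro a b ⟨m, hm⟩ ⟨n, hn⟩
    refine ⟨max m n, ?_⟩
    rw [iterate_map_mul]
    exact mul_mem (iterate_mem hN (le_max_left m n) hm) (iterate_mem hN (le_max_right m n) hn)

/-- The monoid `M_(0)`: all `a ∈ G` such that `σⁿ a ∈ M₀` for some `n`. -/
def Mlim₀ : Submonoid G := limitMonoid M₀ fun _ => σ_mem_M₀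

/-- The monoid `M_(1)`: all `a ∈ G` such that `σⁿ a ∈ M₁` for some `n`. -/
def Mlim₁ : Submonoid G := limitMonoid M₁ fun _ => σ_mem_M₁

/-- The homomorphism `δ : G → ℤ × ℤ` taking `x` to `(1, 0)` and `y` to `(0, 1)`. -/
def δ : G →* Multiplicative (ℤ × ℤ) :=
  FreeGroup.lift ![Multiplicative.ofAdd (1, 0), Multiplicative.ofAdd (0, 1)]

/-- The homomorphism `h ∘ δ : G → ℤ`, restricted to a submonoid `M` of `G`. -/
def hδ (h : ℤ × ℤ →+ ℤ) (M : Submonoid G) : M →* Multiplicative ℤ :=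
  (h.toMultiplicative.comp δ).comp M.subtype

end Cedo

/-! ### Homogeneous components and homogeneous changes of basis -/

namespace GradedSemifir

open Matrix

/-! A free algebra over a division ring, graded through any homomorphism from the free monoid, is a
homogeneous semifir by the weak algorithm (`exists_totalSize_lt`). It therefore suffices to lift one
given relation in `DM` to a free algebra. The finitely many elements in the supports of the `u i`
and `v i` are replaced by words such that the product of a word for `g` (from `u i`) and a word for
`g'` (from `v i`) depends only on `g * g'`. The lifted relation then holds, and its trivialization
maps back to `DM`.

Words in `x`, `y` and powers of `z` have normal forms obtained by rewriting `x y` to `y x z`, and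
the full normal form is determined by the value in `G` (`fullAct_eq_of_evalWord_eq`). A product of
two normal forms need not be normal, since an `x` before the seam may meet a `y` after it. But the
seam of `u i * v i` lies at degree `α i`, and only finitely many such degrees occur; let `H` be
their set. Regard each letter of a word as a step by its degree, and rewrite `x y` only where no
position in `H` is straddled. Such partial normal forms can be cut at `H` (`act_eq_mulNormalForm`).

Equal elements may have different partial normal forms, and `σ` repairs this. An element `g` is read
at level `m` as a word for `σ^m g`, whose letters `x`, `y` carry the degrees of `σ⁻ᵐ x`, `σ⁻ᵐ y`.
These tend to infinity in absolute value because `h ≠ 0`. Under `σ^j` the relation `x y = y x z`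
becomes `q x y = q y x z`: its end stays at a fixed degree while the boundary between the two
rewritten letters moves away and leaves `H`. So at a high enough level the finitely many required
equalities of partial normal forms hold (`eventuallyEquiv_of_evalWord_eq`).

Negative exponents of `z` are absorbed by multiplying with powers of the unit `z` and by using `x
z^(-A)`, `y z^(-A)` as free letters (`exists_encodings`). -/

theorem mem_component_iff {D M A : Type*} [Ring D] [Monoid M] [AddGroup A]
    (f : M →* Multiplicative A) (a : A) (p : MonoidAlgebra D M) :
    p ∈ component D f a ↔ ∀ c ∈ p.coeff.support, (f c).toAdd = a := by
  constructor
  · intro hp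
    induction hp using Submodule.span_induction with
    | mem q hq =>
      obtain ⟨d, hd, rfl⟩ := hq
      intro c hc
      have : c = d := by
        by_contra hne
        simp [Ne.symm hne] at hc
      rw [this]; exact hd
    | zero => simp
    | add q r _ _ hq hr =>
      classical
      intro c hc
      rw [MonoidAlgebra.coeff_add] at hc
      rcases Finset.mem_union.1 (Finsupp.support_add hc) with h | h
      · exact hq c h
      · exact hr c h
    | smul s q _ hq =>
      intro c hc
      rw [MonoidAlgebra.coeff_smul] at hc
      exact hq c (Finsupp.support_smul hc)
  · intro hp
    rw [← MonoidAlgebra.sum_coeff_single p]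
    refine Submodule.sum_mem _ fun c hc => ?_
    have := single_mem_component (D := D) f c (p.coeff c)
    rwa [hp c hc] at this

section Homogeneous

variable {A R S : Type*} [AddGroup A] [Ring R]
  [SetLike S R] [AddSubmonoidClass S R] (𝒜 : A → S) [SetLike.GradedMonoid 𝒜] {m : ℕ}

/-- Matrices whose `(i, j)` entry is homogeneous of degree `-αᵢ + αⱼ`. -/
def IsHomogeneousMatrix (α : Fin m → A) (T : Matrix (Fin m) (Fin m) R) : Prop :=
  ∀ i j, T i j ∈ 𝒜 (-α i + α j)

variable {𝒜} {α : Fin m → A}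

theorem IsHomogeneousMatrix.mul {T U : Matrix (Fin m) (Fin m) R}
    (hT : IsHomogeneousMatrix 𝒜 α T) (hU : IsHomogeneousMatrix 𝒜 α U) :
    IsHomogeneousMatrix 𝒜 α (T * U) := by
  intro i j
  rw [Matrix.mul_apply]
  refine sum_mem fun k _ => ?_
  have := SetLike.mul_mem_graded (hT i k) (hU k j)
  rwa [show -α i + α k + (-α k + α j) = -α i + α j by
    rw [add_assoc, ← add_assoc (α k), add_neg_cancel, zero_add]] at this

theorem isHomogeneousMatrix_one : IsHomogeneousMatrix 𝒜 α (1 : Matrix (Fin m) (Fin m) R) := by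
  intro i j
  rw [Matrix.one_apply]
  split_ifs with h
  · subst h
    rw [neg_add_cancel]
    exact SetLike.one_mem_graded 𝒜
  · exact zero_mem _

theorem Trivializes.mul_left {T U : (Matrix (Fin m) (Fin m) R)ˣ} {u v : Fin m → R}
    (h : Trivializes U (u ᵥ* (T : Matrix (Fin m) (Fin m) R))
      (((T⁻¹ : (Matrix (Fin m) (Fin m) R)ˣ) : Matrix (Fin m) (Fin m) R) *ᵥ v)) :
    Trivializes (T * U) u v := by
  unfold Trivializes at *
  rw [Units.val_mul, _root_.mul_inv_rev, Units.val_mul]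
  rwa [Matrix.vecMul_vecMul, Matrix.mulVec_mulVec] at h

/-- The matrix obtained from the identity matrix by adding the column `t` to
column `k`, where `t k = 0`. -/
def columnUnit (k : Fin m) (t : Fin m → R) (ht : t k = 0) : (Matrix (Fin m) (Fin m) R)ˣ where
  val := 1 + Matrix.of fun i j => if j = k then t i else 0
  inv := 1 - Matrix.of fun i j => if j = k then t i else 0
  val_inv := by
    have : (Matrix.of fun i j : Fin m => if j = k then t i else 0) *
        (Matrix.of fun i j : Fin m => if j = k then t i else 0) = 0 := by
      ext i j
      rw [Matrix.mul_apply]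
      simp [ht]
    rw [mul_sub, add_mul, add_mul, this]; simp
  inv_val := by
    have : (Matrix.of fun i j : Fin m => if j = k then t i else 0) *
        (Matrix.of fun i j : Fin m => if j = k then t i else 0) = 0 := by
      ext i j
      rw [Matrix.mul_apply]
      simp [ht]
    rw [mul_add, sub_mul, sub_mul, this]; simp

theorem vecMul_columnUnit (k : Fin m) (t : Fin m → R) (ht : t k = 0) (u : Fin m → R)
    (j : Fin m) :
    (u ᵥ* (columnUnit k t ht : Matrix (Fin m) (Fin m) R)) j =
      if j = k then u k + ∑ i, u i * t i else u j := by
  simp only [columnUnit, Matrix.vecMul_add, Matrix.vecMul_one, Pi.add_apply]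
  split_ifs with h
  · subst h; simp [Matrix.vecMul, dotProduct]
  · simp [Matrix.vecMul, dotProduct, h]

theorem columnUnit_inv_mulVec (k : Fin m) (t : Fin m → R) (ht : t k = 0) (v : Fin m → R)
    (i : Fin m) :
    ((((columnUnit k t ht)⁻¹ : (Matrix (Fin m) (Fin m) R)ˣ) : Matrix (Fin m) (Fin m) R) *ᵥ v) i =
      v i - t i * v k := by
  change ((1 - Matrix.of fun i j => if j = k then t i else 0 : Matrix _ _ R) *ᵥ v) i = _
  rw [Matrix.sub_mulVec, Matrix.one_mulVec]
  simp [Matrix.mulVec, dotProduct]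

theorem isHomogeneousMatrix_columnUnit (k : Fin m) (t : Fin m → R) (ht : t k = 0)
    (h : ∀ i, t i ∈ 𝒜 (-α i + α k)) :
    IsHomogeneousMatrix 𝒜 α (columnUnit k t ht : Matrix (Fin m) (Fin m) R) := by
  intro i j
  change (1 + Matrix.of fun i j => if j = k then t i else 0 : Matrix _ _ R) i j ∈ _
  rw [Matrix.add_apply]
  refine add_mem (isHomogeneousMatrix_one i j) ?_
  rw [Matrix.of_apply]
  split_ifs with hj
  · subst hj; exact h i
  · exact zero_mem _

end Homogeneous

/-! ### Free algebras -/

section FreeAlgebra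

variable {D X : Type*} [DivisionRing D]

local notation "F" => MonoidAlgebra D (FreeMonoid X)

/-- One more than the degree of a nonzero element of the free algebra; zero at zero. -/
noncomputable def size (p : F) : ℕ := p.coeff.support.sup fun w => w.length + 1

theorem length_lt_size {p : F} {w : FreeMonoid X} (h : p.coeff w ≠ 0) : w.length < size p :=
  Finset.le_sup (f := fun w : FreeMonoid X => w.length + 1) (Finsupp.mem_support_iff.2 h)

theorem size_le {p : F} {n : ℕ} (h : ∀ w : FreeMonoid X, p.coeff w ≠ 0 → w.length < n) :
    size p ≤ n :=
  Finset.sup_le fun w hw => h w (Finsupp.mem_support_iff.1 hw)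

theorem exists_length_add_one_eq_size {p : F} (h : p ≠ 0) :
    ∃ w : FreeMonoid X, p.coeff w ≠ 0 ∧ w.length + 1 = size p := by
  have hne : p.coeff.support.Nonempty := by
    rwa [Finsupp.support_nonempty_iff, Ne, MonoidAlgebra.coeff_eq_zero]
  obtain ⟨w, hw, hmax⟩ := Finset.exists_max_image p.coeff.support (fun w => w.length) hne
  refine ⟨w, Finsupp.mem_support_iff.1 hw, le_antisymm (length_lt_size
    (Finsupp.mem_support_iff.1 hw)) (size_le fun w' hw' => Nat.lt_succ_of_le (hmax w'
      (Finsupp.mem_support_iff.2 hw')))⟩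

theorem mul_right_injective_freeMonoid (w : FreeMonoid X) :
    Function.Injective fun a : FreeMonoid X => a * w :=
  fun _ _ h => List.append_cancel_right h

/-- Right cofactor of the word `w`: the coefficient of `a` is that of `a * w` in the
given element. -/
noncomputable def cofactor (w : FreeMonoid X) (p : F) : F :=
  p.comapDomain (fun a => a * w) (mul_right_injective_freeMonoid w)

theorem coeff_cofactor (w : FreeMonoid X) (p : F) (a : FreeMonoid X) :
    (cofactor w p).coeff a = p.coeff (a * w) := by
  simp [cofactor]

theorem exists_mul_eq_of_coeff_mul_ne_zero {D M : Type*} [Ring D] [Monoid M]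
    {p q : MonoidAlgebra D M} {c : M} (h : (p * q).coeff c ≠ 0) :
    ∃ a b, p.coeff a ≠ 0 ∧ q.coeff b ≠ 0 ∧ a * b = c := by
  classical
  obtain ⟨a, ha, b, hb, rfl⟩ :=
    Finset.mem_mul.1 (MonoidAlgebra.support_coeff_mul_subset p q (Finsupp.mem_support_iff.2 h))
  exact ⟨a, b, Finsupp.mem_support_iff.1 ha, Finsupp.mem_support_iff.1 hb, rfl⟩

theorem coeff_mul_single_right (w a : FreeMonoid X) (p : F) (c : D) :
    (p * MonoidAlgebra.single w c).coeff (a * w) = p.coeff a * c :=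
  MonoidAlgebra.coeff_mul_single_eq_coeff_mul a fun b _ =>
    ⟨fun h => mul_right_injective_freeMonoid w h, fun h => by rw [h]⟩

theorem coeff_sub_cofactor (w a : FreeMonoid X) (p : F) :
    (p - cofactor w p * MonoidAlgebra.single w 1).coeff (a * w) = 0 := by
  rw [MonoidAlgebra.coeff_sub, Finsupp.sub_apply, coeff_mul_single_right, coeff_cofactor,
    mul_one, sub_self]

theorem coeff_sub_cofactor_ne_zero {w s : FreeMonoid X} {p : F}
    (h : (p - cofactor w p * MonoidAlgebra.single w 1).coeff s ≠ 0) : p.coeff s ≠ 0 := by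
  intro hs
  rw [MonoidAlgebra.coeff_sub, Finsupp.sub_apply, hs, zero_sub, neg_ne_zero] at h
  obtain ⟨a, b, ha, hb, rfl⟩ := exists_mul_eq_of_coeff_mul_ne_zero h
  have : b = w := by
    by_contra hne
    simp [Ne.symm hne] at hb
  subst this
  exact ha (by rw [coeff_cofactor, hs])

/-- Cofactors of a linear relation form a relation in high degrees. -/
theorem coeff_sum_mul_cofactor_eq_zero {ι : Type*} (I : Finset ι) (u v : ι → F)
    (h : ∑ i ∈ I, u i * v i = 0) (w b : FreeMonoid X)
    (hb : ∀ i ∈ I, ∀ a s : FreeMonoid X, (u i).coeff a ≠ 0 → (v i).coeff s ≠ 0 →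
      s.length < w.length → a.length + s.length = b.length + w.length → False) :
    (∑ i ∈ I, u i * cofactor w (v i)).coeff b = 0 := by
  have h1 : ∑ i ∈ I, u i * (v i - cofactor w (v i) * MonoidAlgebra.single w 1) =
      -((∑ i ∈ I, u i * cofactor w (v i)) * MonoidAlgebra.single w 1) := by
    simp only [mul_sub, Finset.sum_sub_distrib, h, zero_sub, Finset.sum_mul, mul_assoc]
  have h2 := congrArg (fun p : F => p.coeff (b * w)) h1
  simp only [MonoidAlgebra.coeff_neg, Finsupp.neg_apply, coeff_mul_single_right, mul_one] at h2
  rw [eq_comm, neg_eq_iff_eq_neg] at h2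
  rw [h2, neg_eq_zero, MonoidAlgebra.coeff_sum, Finsupp.finsetSum_apply]
  refine Finset.sum_eq_zero fun i hi => ?_
  by_contra hne
  obtain ⟨a, s, ha, hs, has⟩ := exists_mul_eq_of_coeff_mul_ne_zero hne
  have hlen : a.length + s.length = b.length + w.length := by
    rw [← FreeMonoid.length_mul, ← FreeMonoid.length_mul, has]
  refine hb i hi a s ha (coeff_sub_cofactor_ne_zero hs) ?_ hlen
  -- A suffix of `b * w` at least as long as `w` ends in `w`, and the remainder of `v i` has no such
  -- words.
  by_contra hlt
  have : ∃ s', s' * w = s := by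
    have h3 : w.toList <:+ b.toList ++ w.toList := List.suffix_append _ _
    have h4 : s.toList <:+ b.toList ++ w.toList := ⟨a.toList, has⟩
    exact List.suffix_of_suffix_length_le h3 h4 (not_lt.1 hlt)
  obtain ⟨s', rfl⟩ := this
  exact hs (coeff_sub_cofactor w s' (v i))

theorem size_eq_zero {p : F} : size p = 0 ↔ p = 0 := by
  constructor
  · intro h
    by_contra hp
    obtain ⟨w, hw, hl⟩ := exists_length_add_one_eq_size hp
    omega
  · rintro rfl
    exact Nat.le_zero.1 (size_le fun w hw => (hw rfl).elim)

theorem size_mul_single_one_le (p : F) (c : D) : size (p * MonoidAlgebra.single 1 c) ≤ size p := by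
  refine size_le fun w hw => length_lt_size fun h => hw ?_
  rw [MonoidAlgebra.coeff_mul_single_one, h, zero_mul]

theorem size_add_le (p q : F) : size (p + q) ≤ max (size p) (size q) := by
  refine size_le fun w hw => ?_
  by_cases hp : p.coeff w = 0
  · refine (length_lt_size fun hq => hw ?_).trans_le (le_max_right _ _)
    rw [MonoidAlgebra.coeff_add, Finsupp.add_apply, hp, hq, add_zero]
  · exact (length_lt_size hp).trans_le (le_max_left _ _)

theorem size_neg (p : F) : size (-p) = size p := by
  simp only [size, MonoidAlgebra.coeff_neg, Finsupp.support_neg]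

/-- Taking the cofactor removes `w` from the end of words of `p`, and no word of `q` is longer than
`w`. -/
theorem size_cofactor_mul_le {w : FreeMonoid X} {q : F} (hq : size q = w.length + 1) (p : F)
    (c : D) : size (cofactor w p * MonoidAlgebra.single 1 c * q) ≤ size p := by
  refine size_le fun x hx => ?_
  obtain ⟨a, s, ha, hs, rfl⟩ := exists_mul_eq_of_coeff_mul_ne_zero hx
  rw [MonoidAlgebra.coeff_mul_single_one] at ha
  have h1 := left_ne_zero_of_mul ha
  rw [coeff_cofactor] at h1
  have h2 := length_lt_size h1
  have h3 := length_lt_size hs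
  rw [FreeMonoid.length_mul] at h2 ⊢
  omega

theorem cofactor_self {w : FreeMonoid X} {q : F} (hq : size q = w.length + 1) :
    cofactor w q = MonoidAlgebra.single 1 (q.coeff w) := by
  classical
  ext a
  rw [coeff_cofactor, MonoidAlgebra.coeff_single, Finsupp.single_apply]
  split_ifs with h
  · rw [← h, one_mul]
  · by_contra hne
    have := length_lt_size hne
    rw [FreeMonoid.length_mul] at this
    exact h (FreeMonoid.length_eq_zero.1 (by omega)).symm

theorem cofactor_mul_single_mem_component {A : Type*} [AddGroup A]
    (f : FreeMonoid X →* Multiplicative A) {a b : A} (w : FreeMonoid X) (hw : (f w).toAdd = b)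
    {p : F} (hp : p ∈ component D f a) (c : D) :
    cofactor w p * MonoidAlgebra.single 1 c ∈ component D f (a - b) := by
  rw [mem_component_iff] at hp ⊢
  intro x hx
  rw [Finsupp.mem_support_iff, MonoidAlgebra.coeff_mul_single_one, coeff_cofactor] at hx
  have := hp _ (Finsupp.mem_support_iff.2 (left_ne_zero_of_mul hx))
  rw [map_mul, toAdd_mul, hw] at this
  exact eq_sub_of_add_eq this

theorem sum_vecMul_mulVec {R : Type*} [Ring R] {m : ℕ} (T : (Matrix (Fin m) (Fin m) R)ˣ)
    (u v : Fin m → R) :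
    ∑ i, (u ᵥ* (T : Matrix (Fin m) (Fin m) R)) i *
      (((T⁻¹ : (Matrix (Fin m) (Fin m) R)ˣ) : Matrix (Fin m) (Fin m) R) *ᵥ v) i =
      ∑ i, u i * v i := by
  change (u ᵥ* (T : Matrix (Fin m) (Fin m) R)) ⬝ᵥ _ = u ⬝ᵥ v
  rw [← Matrix.dotProduct_mulVec, Matrix.mulVec_mulVec, ← Units.val_mul, mul_inv_cancel,
    Units.val_one, Matrix.one_mulVec]

theorem IsHomogeneousRelation.transform {A R S : Type*} [AddGroup A] [DecidableEq A] [Ring R]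
    [SetLike S R] [AddSubmonoidClass S R] {𝒜 : A → S} [GradedRing 𝒜] {m : ℕ}
    {α : Fin m → A} {β : A} {u v : Fin m → R} (h : IsHomogeneousRelation 𝒜 α β u v)
    (T : (Matrix (Fin m) (Fin m) R)ˣ)
    (hT : IsHomogeneousMatrix 𝒜 α (T : Matrix (Fin m) (Fin m) R))
    (hT' : IsHomogeneousMatrix 𝒜 α
      ((T⁻¹ : (Matrix (Fin m) (Fin m) R)ˣ) : Matrix (Fin m) (Fin m) R)) :
    IsHomogeneousRelation 𝒜 α β (u ᵥ* (T : Matrix (Fin m) (Fin m) R))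
      (((T⁻¹ : (Matrix (Fin m) (Fin m) R)ˣ) : Matrix (Fin m) (Fin m) R) *ᵥ v) where
  left_mem j := by
    change ∑ i, u i * (T : Matrix (Fin m) (Fin m) R) i j ∈ 𝒜 (α j)
    refine sum_mem fun i _ => ?_
    have := SetLike.mul_mem_graded (h.left_mem i) (hT i j)
    rwa [add_neg_cancel_left] at this
  right_mem i := by
    change ∑ j, ((T⁻¹ : (Matrix (Fin m) (Fin m) R)ˣ) : Matrix (Fin m) (Fin m) R) i j * v j ∈ _
    refine sum_mem fun j _ => ?_
    have := SetLike.mul_mem_graded (hT' i j) (h.right_mem j)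
    rwa [add_assoc, add_neg_cancel_left] at this
  sum_eq_zero := by rw [sum_vecMul_mulVec, h.sum_eq_zero]

/-- The total size of the relation, which the weak algorithm reduces. -/
noncomputable def totalSize {m : ℕ} (u v : Fin m → F) : ℕ := ∑ i, (size (u i) + size (v i))

/-- One step of the weak algorithm: a nontrivial homogeneous relation in the free algebra can
be transformed to one of smaller size. -/
theorem exists_totalSize_lt {A : Type*} [AddGroup A] [DecidableEq A]
    (f : FreeMonoid X →* Multiplicative A) {m : ℕ}
    {α : Fin m → A} {β : A} {u v : Fin m → F}
    (h : IsHomogeneousRelation (component D f) α β u v) (hne : ¬ IsTrivial u v) :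
    ∃ T : (Matrix (Fin m) (Fin m) F)ˣ,
      IsHomogeneousMatrix (component D f) α (T : Matrix (Fin m) (Fin m) F) ∧
      IsHomogeneousMatrix (component D f) α
        ((T⁻¹ : (Matrix (Fin m) (Fin m) F)ˣ) : Matrix (Fin m) (Fin m) F) ∧
      totalSize (u ᵥ* (T : Matrix (Fin m) (Fin m) F))
        (((T⁻¹ : (Matrix (Fin m) (Fin m) F)ˣ) : Matrix (Fin m) (Fin m) F) *ᵥ v) <
        totalSize u v := by
  classical
  set I : Finset (Fin m) := Finset.univ.filter fun i => u i ≠ 0 ∧ v i ≠ 0 with hI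
  have hIne : I.Nonempty := by
    simp only [IsTrivial, not_forall, not_or] at hne
    obtain ⟨i, hi⟩ := hne
    exact ⟨i, by simp [hI, hi]⟩
  -- The index `k` maximizes the total degree of `u i * v i`; among ties `v k` is shortest. The
  -- tie-break is what makes the leading word `w` of `v k` usable for cofactors of all the `v i`.
  obtain ⟨k, hkI, hkmax⟩ : ∃ k ∈ I, ∀ i ∈ I,
      size (u i) + size (v i) < size (u k) + size (v k) ∨
      size (u i) + size (v i) ≤ size (u k) + size (v k) ∧ size (v k) ≤ size (v i) := by
    obtain ⟨k₀, hk₀, hmax⟩ := Finset.exists_max_image I (fun i => size (u i) + size (v i)) hIne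
    obtain ⟨k, hk, hmin⟩ := Finset.exists_min_image
      (I.filter fun i => size (u i) + size (v i) = size (u k₀) + size (v k₀))
      (fun i => size (v i)) ⟨k₀, by simp [hk₀]⟩
    rw [Finset.mem_filter] at hk
    refine ⟨k, hk.1, fun i hi => ?_⟩
    rw [hk.2]
    rcases (hmax i hi).lt_or_eq with hlt | heq
    · exact Or.inl hlt
    · exact Or.inr ⟨heq.le, hmin i (by simp [hi, heq])⟩
  have hk : u k ≠ 0 ∧ v k ≠ 0 := by simpa [hI] using hkI
  obtain ⟨w, hw, hwl⟩ := exists_length_add_one_eq_size hk.2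
  obtain ⟨w', hw', hwl'⟩ := exists_length_add_one_eq_size hk.1
  have hdw : (f w).toAdd = -α k + β :=
    (mem_component_iff f _ _).1 (h.right_mem k) w (Finsupp.mem_support_iff.2 hw)
  set c : D := (v k).coeff w with hc
  set t : Fin m → F := fun i =>
    if i ∈ I ∧ i ≠ k then cofactor w (v i) * MonoidAlgebra.single 1 c⁻¹ else 0 with ht
  have htk : t k = 0 := by simp [ht]
  have htmem : ∀ i, t i ∈ component D f (-α i + α k) := by
    intro i
    simp only [ht]
    split_ifs
    · have := cofactor_mul_single_mem_component f w hdw (h.right_mem i) c⁻¹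
      rwa [show -α i + β - (-α k + β) = -α i + α k by
        rw [sub_eq_add_neg, neg_add_rev, neg_neg, add_assoc, add_neg_cancel_left]] at this
    · exact zero_mem _
  have hsumI : ∑ i ∈ I, u i * v i = 0 := by
    rw [← h.sum_eq_zero]
    refine Finset.sum_subset (Finset.subset_univ I) fun i _ hi => ?_
    simp only [hI, Finset.mem_filter, Finset.mem_univ, true_and, not_and_or, not_not] at hi
    rcases hi with hi | hi <;> simp [hi]
  have hinv : (MonoidAlgebra.single (1 : FreeMonoid X) c) * MonoidAlgebra.single 1 c⁻¹ = 1 := by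
    rw [MonoidAlgebra.single_mul_single, mul_one, mul_inv_cancel₀ hw, MonoidAlgebra.one_def]
  -- The factor `c⁻¹` turns the cofactor of `v k` itself into `1`, so the new `u k` is the full sum
  -- of the `u i` times cofactors, whose top coefficients vanish.
  have hnew : u k + ∑ i, u i * t i =
      (∑ i ∈ I, u i * cofactor w (v i)) * MonoidAlgebra.single 1 c⁻¹ := by
    rw [← Finset.add_sum_erase I _ hkI, add_mul, cofactor_self hwl.symm, ← hc, mul_assoc, hinv,
      mul_one, Finset.sum_mul]
    congr 1
    rw [← Finset.sum_subset (Finset.subset_univ (I.erase k))]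
    · refine Finset.sum_congr rfl fun i hi => ?_
      rw [Finset.mem_erase] at hi
      simp only [ht, if_pos (And.intro hi.2 hi.1), mul_assoc]
    · intro i _ hi
      rw [Finset.mem_erase] at hi
      simp only [ht, if_neg (fun hh : i ∈ I ∧ i ≠ k => hi ⟨hh.2, hh.1⟩), mul_zero]
  have hlt : size (u k + ∑ i, u i * t i) < size (u k) := by
    rw [hnew]
    refine (size_mul_single_one_le _ _).trans_lt ?_
    rw [← hwl', Nat.lt_succ_iff]
    refine size_le fun b hb => ?_
    by_contra hbl
    refine hb (coeff_sum_mul_cofactor_eq_zero I u v hsumI w b ?_)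
    intro i hi a s ha hs hsl hlen
    have h1 := length_lt_size ha
    have h2 := length_lt_size hs
    -- An exceptional term would reach the maximal total degree with `v i` shorter than `v k`,
    -- against the choice of `k`.
    rcases hkmax i hi with h3 | ⟨h3, h4⟩ <;> omega
  refine ⟨columnUnit k t htk, isHomogeneousMatrix_columnUnit k t htk htmem, ?_, ?_⟩
  · have hneg : (((columnUnit k t htk)⁻¹ : (Matrix (Fin m) (Fin m) F)ˣ) :
        Matrix (Fin m) (Fin m) F) = columnUnit k (-t) (by simp [htk]) := by
      change (1 - Matrix.of fun i j => if j = k then t i else 0 : Matrix _ _ F) =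
        1 + Matrix.of fun i j => if j = k then (-t) i else 0
      rw [sub_eq_add_neg]
      congr 1
      ext1 i j
      by_cases hj : j = k <;> simp [hj]
    rw [hneg]
    exact isHomogeneousMatrix_columnUnit k _ _ fun i => neg_mem (htmem i)
  · refine Finset.sum_lt_sum (fun i _ => ?_) ⟨k, Finset.mem_univ k, ?_⟩
    · refine add_le_add ?_ ?_
      · rw [vecMul_columnUnit]
        split_ifs with hik
        · rw [hik]; exact hlt.le
        · exact le_rfl
      · rw [columnUnit_inv_mulVec, sub_eq_add_neg]
        refine (size_add_le _ _).trans (max_le le_rfl ?_)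
        rw [size_neg]
        simp only [ht]
        split_ifs
        · exact size_cofactor_mul_le hwl.symm _ _
        · simp [size_eq_zero.2]
    · rw [vecMul_columnUnit, if_pos rfl, columnUnit_inv_mulVec, htk, zero_mul, sub_zero]
      exact Nat.add_lt_add_right hlt _

/-- A free algebra over a division ring, graded by any degree function on the free monoid,
is a homogeneous semifir. -/
theorem isHomogeneousSemifir_freeMonoid {A : Type*} [AddGroup A] [DecidableEq A]
    (f : FreeMonoid X →* Multiplicative A) : IsHomogeneousSemifir (component D f) := by
  intro n m _ α β u v
  induction hN : totalSize u v using Nat.strong_induction_on generalizing u v with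
  | _ N ih =>
    intro h
    by_cases htriv : IsTrivial u v
    · refine ⟨1, isHomogeneousMatrix_one, ?_⟩
      simpa [Trivializes] using htriv
    · obtain ⟨T, hT, hT', hlt⟩ := exists_totalSize_lt f h htriv
      obtain ⟨U, hU, hUtriv⟩ := ih _ (hN ▸ hlt) _ _ rfl (h.transform T hT hT')
      exact ⟨T * U, hT.mul hU, hUtriv.mul_left⟩

end FreeAlgebra

end GradedSemifir

namespace Cedo

/-! ### Words and partial normal forms -/

/-- The letters `x`, `y` and the powers of `z`. -/
inductive Letter
  | x
  | y
  | z (k : ℤ)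

/-- Normal forms `z ^ k₀ * l₁ * z ^ k₁ * l₂ * ⋯ * lᵣ * z ^ kᵣ`, where each `lᵢ` is `x` (`true`) or
`y` (`false`). -/
abbrev NormalForm := ℤ × List (Bool × ℤ)

section Action

variable (a b : ℤ) (good : ℤ → Bool)

/-- Multiplication of `z ^ k * l₁ * z ^ k₁ * ⋯` on the left by `x`, at position `e`: the
rewriting `x * y = y * x * z` is performed at good positions only. -/
def pushX : ℤ → ℤ → List (Bool × ℤ) → List (Bool × ℤ)
  | _, k, [] => [(true, k)]
  | _, k, (true, k') :: L => (true, k) :: (true, k') :: L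
  | e, k, (false, k') :: L =>
    if k = 0 ∧ good e = true then (false, 0) :: pushX (e + b) (k' + 1) L
    else (true, k) :: (false, k') :: L

/-- Multiplication of a normal form on the left by a letter, at position `e`. -/
def letterAct (e : ℤ) : Letter → NormalForm → NormalForm
  | .x, p => (0, pushX b good e p.1 p.2)
  | .y, p => (0, (false, p.1) :: p.2)
  | .z k, p => (p.1 + k, p.2)

/-- The degree of a letter, where `x` has degree `a` and `y` has degree `b`. -/
def Letter.degree : Letter → ℤ
  | .x => a
  | .y => b
  | .z _ => 0

/-- The degree of a word. -/
def wordDegree (w : List Letter) : ℤ := (w.map (Letter.degree a b)).sum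

/-- Multiplication of a normal form on the left by a word, at position `e`. -/
def act : ℤ → List Letter → NormalForm → NormalForm
  | _, [], p => p
  | e, l :: w, p => letterAct b good e l (act (e + l.degree a b) w p)

@[simp] theorem wordDegree_nil : wordDegree a b [] = 0 := rfl

@[simp] theorem wordDegree_cons (l : Letter) (w : List Letter) :
    wordDegree a b (l :: w) = l.degree a b + wordDegree a b w := by simp [wordDegree]

theorem wordDegree_append (w w' : List Letter) :
    wordDegree a b (w ++ w') = wordDegree a b w + wordDegree a b w' := by simp [wordDegree]

theorem act_append (e : ℤ) (w w' : List Letter) (p : NormalForm) :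
    act a b good e (w ++ w') p =
      act a b good e w (act a b good (e + wordDegree a b w) w' p) := by
  induction w generalizing e with
  | nil => simp [act]
  | cons l w ih => simp [act, ih, add_assoc]

theorem act_x_y (e : ℤ) (h : good e = true) (p : NormalForm) :
    act a b good e [.x, .y] p = act a b good e [.y, .x, .z 1] p := by
  simp [act, letterAct, pushX, h, Letter.degree]

end Action

/-! ### Evaluation in the free group -/

/-- The value of a letter in `G`. -/
def Letter.eval : Letter → G
  | .x => Cedo.x
  | .y => Cedo.y
  | .z k => Cedo.z ^ k

/-- The value of a word in `G`. -/
def evalWord (w : List Letter) : G := (w.map Letter.eval).prod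

/-- The generator `x` or `y`. -/
def gen (l : Bool) : G := if l then x else y

/-- The value in `G` of the list of letters of a normal form. -/
def evalTail (L : List (Bool × ℤ)) : G := (L.map fun l => gen l.1 * z ^ l.2).prod

/-- The value of a normal form in `G`. -/
def evalNormalForm (p : NormalForm) : G := z ^ p.1 * evalTail p.2

@[simp] theorem evalWord_nil : evalWord [] = 1 := rfl

@[simp] theorem evalWord_cons (l : Letter) (w : List Letter) :
    evalWord (l :: w) = l.eval * evalWord w := by simp [evalWord]

theorem evalWord_append (w w' : List Letter) :
    evalWord (w ++ w') = evalWord w * evalWord w' := by simp [evalWord]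

@[simp] theorem evalTail_nil : evalTail [] = 1 := rfl

@[simp] theorem evalTail_cons (l : Bool × ℤ) (L : List (Bool × ℤ)) :
    evalTail (l :: L) = gen l.1 * z ^ l.2 * evalTail L := by simp [evalTail]

theorem x_mul_y : x * y = y * x * z := by simp [z, mul_assoc]

theorem evalTail_pushX (b : ℤ) (good : ℤ → Bool) (e k : ℤ) (L : List (Bool × ℤ)) :
    evalTail (pushX b good e k L) = x * (z ^ k * evalTail L) := by
  induction L generalizing e k with
  | nil => simp [pushX, gen]
  | cons l L ih =>
    obtain ⟨_ | _, k'⟩ := l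
    · rw [pushX]
      split_ifs with h
      · simp only [evalTail_cons, ih, h.1, gen, zpow_zero, mul_one, one_mul, zpow_add_one,
          Bool.false_eq_true, if_false]
        rw [mul_assoc y, ← mul_assoc x y, x_mul_y, (Commute.zpow_self z k').eq]
        simp only [mul_assoc]
      · simp [gen, mul_assoc]
    · simp [pushX, gen, mul_assoc]

theorem evalNormalForm_act (a b : ℤ) (good : ℤ → Bool) (e : ℤ) (w : List Letter)
    (p : NormalForm) :
    evalNormalForm (act a b good e w p) = evalWord w * evalNormalForm p := by
  induction w generalizing e with
  | nil => simp [act]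
  | cons l w ih =>
    rw [act, evalWord_cons, mul_assoc, ← ih (e + l.degree a b)]
    cases l with
    | x => simp [letterAct, evalNormalForm, evalTail_pushX, Letter.eval]
    | y => simp [letterAct, evalNormalForm, Letter.eval, gen, mul_assoc]
    | z k => simp [letterAct, evalNormalForm, Letter.eval, ← mul_assoc, ← zpow_add, add_comm]

/-! ### Words with the same value have the same full normal form -/

/-- The complement of the range, whatever its size, is absorbed by the countably many added points.
-/
theorem exists_perm_extending {α : Type*} [Countable α] (f : α → α) (hf : Function.Injective f) :
    ∃ π : Equiv.Perm (α ⊕ ℕ), ∀ p, π (Sum.inl p) = Sum.inl (f p) := by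
  classical
  have : Infinite (((Set.range f)ᶜ : Set α) ⊕ ℕ) := Sum.infinite_of_right
  obtain ⟨ε⟩ := nonempty_equiv_of_countable (α := ℕ) (β := ((Set.range f)ᶜ : Set α) ⊕ ℕ)
  refine ⟨((Equiv.ofInjective f hf).sumCongr ε).trans
    ((Equiv.sumAssoc _ _ _).symm.trans ((Equiv.Set.sumCompl (Set.range f)).sumCongr
      (Equiv.refl ℕ))), fun p => ?_⟩
  simp

/-- The leading letters of the result reveal which branch was taken: a leading `y` means that `x`
was pushed past it. -/
theorem pushX_injective (b e : ℤ) (good : ℤ → Bool) :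
    Function.Injective fun p : NormalForm => pushX b good e p.1 p.2 := by
  rintro ⟨k, L⟩ ⟨k₁, L₁⟩ h
  simp only at h
  induction L generalizing e k k₁ L₁ with
  | nil =>
    rcases L₁ with _ | ⟨⟨_ | _, k₂⟩, L₁⟩ <;> simp only [pushX] at h
    · simpa using h
    · split_ifs at h <;> simp at h
    · simp at h
  | cons l L ih =>
    obtain ⟨_ | _, k'⟩ := l <;> rcases L₁ with _ | ⟨⟨_ | _, k₂⟩, L₁⟩ <;> simp only [pushX] at h
    · split_ifs at h <;> simp at h
    · split_ifs at h with h1 h2 h2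
      · simp only [List.cons.injEq, true_and] at h
        have := ih _ _ _ _ h
        simp only [Prod.mk.injEq, add_left_inj] at this
        simp [this, h1.1, h2.1]
      · simp at h
      · simp at h
      · simpa using h
    · split_ifs at h <;> simp at h
    · simp at h
    · split_ifs at h <;> simp at h
    · simpa using h

/-- The action of words on normal forms in which every position is good. -/
abbrev fullAct (w : List Letter) (p : NormalForm) : NormalForm := act 0 0 (fun _ => true) 0 w p

theorem fullAct_cons (l : Letter) (w : List Letter) (p : NormalForm) :
    fullAct (l :: w) p = letterAct 0 (fun _ => true) 0 l (fullAct w p) := by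
  cases l <;> rfl

/-- As `G` is free, only `x` and `y` need permutations. The action of `z` on normal forms is then
forced by `x y = y x z`, because the permutations for `x` and `y` are injective. -/
theorem exists_hom_perm : ∃ ρ : G →* Equiv.Perm (NormalForm ⊕ ℕ),
    ∀ w p, ρ (evalWord w) (Sum.inl p) = Sum.inl (fullAct w p) := by
  obtain ⟨X, hX⟩ := exists_perm_extending (letterAct 0 (fun _ => true) 0 .x) (by
    intro p q h
    exact pushX_injective 0 0 _ (by simpa [letterAct] using h))
  obtain ⟨Y, hY⟩ := exists_perm_extending (letterAct 0 (fun _ => true) 0 .y) (by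
    rintro ⟨k, L⟩ ⟨k₁, L₁⟩ h
    simpa [letterAct] using h)
  let ρ : G →* Equiv.Perm (NormalForm ⊕ ℕ) := FreeGroup.lift ![X, Y]
  have hx : ρ x = X := by simp [ρ, x]
  have hy : ρ y = Y := by simp [ρ, y]
  have hz : ∀ p : NormalForm, ρ z (Sum.inl p) = Sum.inl (p.1 + 1, p.2) := by
    intro p
    have h1 : ρ x * ρ y = ρ y * ρ x * ρ z := by rw [← map_mul, x_mul_y, map_mul, map_mul]
    have h2 := congrArg (fun π : Equiv.Perm _ => π (Sum.inl p)) h1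
    simp only [Equiv.Perm.mul_apply, hx, hy, hX, hY] at h2
    have h3 := act_x_y 0 0 (fun _ => true) 0 rfl p
    simp only [act, Letter.degree, add_zero] at h3
    rw [h3, ← hY, ← hX] at h2
    exact (X.injective (Y.injective h2)).symm
  have hzk : ∀ (k : ℤ) (p : NormalForm), ρ (z ^ k) (Sum.inl p) = Sum.inl (p.1 + k, p.2) := by
    intro k
    induction k with
    | zero => simp
    | succ k ih =>
      intro p
      rw [zpow_add_one, map_mul, Equiv.Perm.mul_apply, hz, ih]
      rw [add_assoc, add_comm 1]
    | pred k ih =>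
      intro p
      have h1 : ρ z (Sum.inl (p.1 - 1, p.2)) = Sum.inl p := by rw [hz]; simp
      rw [zpow_sub_one, map_mul, Equiv.Perm.mul_apply, map_inv, Equiv.Perm.inv_eq_iff_eq.2 h1.symm,
        ih]
      rw [sub_add_eq_add_sub, add_sub_assoc]
  refine ⟨ρ, fun w => ?_⟩
  induction w with
  | nil => intro p; simp [fullAct, act]
  | cons l w ih =>
    intro p
    rw [evalWord_cons, map_mul, Equiv.Perm.mul_apply, ih, fullAct_cons]
    cases l with
    | x => rw [Letter.eval, hx, hX]
    | y => rw [Letter.eval, hy, hY]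
    | z k => rw [Letter.eval, hzk]; rfl

theorem fullAct_eq_of_evalWord_eq {w w' : List Letter} (h : evalWord w = evalWord w')
    (p : NormalForm) : fullAct w p = fullAct w' p := by
  obtain ⟨ρ, hρ⟩ := exists_hom_perm
  have := hρ w p
  rw [h, hρ w' p] at this
  exact (Sum.inl_injective this).symm

end Cedo

namespace Cedo

open Filter

/-! ### Substitution and eventual equality of normal forms -/

/-- The substitution `x ↦ y x`, `y ↦ y x y` on words. -/
def subst (w : List Letter) : List Letter :=
  w.flatMap fun
    | .x => [.y, .x]
    | .y => [.y, .x, .y]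
    | .z k => [.z k]

theorem subst_append (w w' : List Letter) : subst (w ++ w') = subst w ++ subst w' := by
  simp [subst]

theorem iterate_subst_append (j : ℕ) (w w' : List Letter) :
    subst^[j] (w ++ w') = subst^[j] w ++ subst^[j] w' := by
  induction j generalizing w w' with
  | zero => rfl
  | succ j ih => rw [Function.iterate_succ_apply, subst_append, ih]; rfl

theorem iterate_subst_z (j : ℕ) (k : ℤ) (w : List Letter) :
    subst^[j] (.z k :: w) = .z k :: subst^[j] w := by
  induction j generalizing w with
  | zero => rfl
  | succ j ih => exact ih (subst w)

theorem σ_zpow_z (k : ℤ) : σ (z ^ k) = z ^ k := by rw [map_zpow, σ_z]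

theorem evalWord_subst (w : List Letter) : evalWord (subst w) = σ (evalWord w) := by
  induction w with
  | nil => simp [subst]
  | cons l w ih =>
    rw [← List.singleton_append, subst_append, evalWord_append, ih, List.singleton_append,
      evalWord_cons, map_mul]
    congr 1
    cases l <;> simp [subst, Letter.eval, σ_x, σ_y, σ_zpow_z, mul_assoc]

theorem evalWord_iterate_subst (j : ℕ) (w : List Letter) :
    evalWord (subst^[j] w) = σ^[j] (evalWord w) := by
  induction j with
  | zero => rfl
  | succ j ih =>
    rw [Function.iterate_succ_apply', evalWord_subst, ih, Function.iterate_succ_apply']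

/-- The images `y x y x y` and `y x y y x z` share the prefix `y x y`, after which the original
relation reappears. Substitution thus only lengthens the common prefix. -/
theorem exists_iterate_subst_x_y (j : ℕ) : ∃ q : List Letter,
    subst^[j] [.x, .y] = q ++ [.x, .y] ∧ subst^[j] [.y, .x, .z 1] = q ++ [.y, .x, .z 1] := by
  induction j with
  | zero => exact ⟨[], rfl, rfl⟩
  | succ j ih =>
    obtain ⟨q, h1, h2⟩ := ih
    refine ⟨subst q ++ [.y, .x, .y], ?_, ?_⟩
    · rw [Function.iterate_succ_apply', h1, subst_append]; simp [subst]
    · rw [Function.iterate_succ_apply', h2, subst_append]; simp [subst]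

/-- A sequence of degrees `a m`, `b m` of `σ⁻ᵐ x` and `σ⁻ᵐ y`, tending to infinity in absolute
value. -/
structure DegreeSequence where
  /-- The degree of `σ⁻ᵐ x`. -/
  a : ℕ → ℤ
  /-- The degree of `σ⁻ᵐ y`. -/
  b : ℕ → ℤ
  a_eq : ∀ m, a m = b (m + 1) + a (m + 1)
  b_eq : ∀ m, b m = b (m + 1) + a (m + 1) + b (m + 1)
  a_ne : ∀ c, ∀ᶠ m in atTop, a m ≠ c
  b_ne : ∀ c, ∀ᶠ m in atTop, b m ≠ c

variable (d : DegreeSequence) (H : Finset ℤ)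

/-- At good positions, the relation `x * y = y * x * z` straddles no position in `H`. -/
def isGood (a b : ℤ) (e : ℤ) : Bool := decide (e + a ∉ H ∧ e + b ∉ H)

/-- The action of words at level `m`. -/
def levelAct (m : ℕ) (e : ℤ) (w : List Letter) (p : NormalForm) : NormalForm :=
  act (d.a m) (d.b m) (isGood H (d.a m) (d.b m)) e w p

theorem wordDegree_subst (m : ℕ) (w : List Letter) :
    wordDegree (d.a (m + 1)) (d.b (m + 1)) (subst w) = wordDegree (d.a m) (d.b m) w := by
  induction w with
  | nil => rfl
  | cons l w ih =>
    rw [← List.singleton_append, subst_append, wordDegree_append, wordDegree_append, ih]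
    congr 1
    cases l <;> simp [subst, Letter.degree, d.a_eq m, d.b_eq m, add_assoc]

theorem wordDegree_iterate_subst (n j : ℕ) (w : List Letter) :
    wordDegree (d.a (n + j)) (d.b (n + j)) (subst^[j] w) = wordDegree (d.a n) (d.b n) w := by
  induction j with
  | zero => rfl
  | succ j ih => rw [Function.iterate_succ_apply', ← add_assoc, wordDegree_subst, ih]

/-- Two words at level `n` are eventually equivalent if they have the same degree and, at each
position, act in the same way when transported to all large levels. -/
def EventuallyEquiv (n : ℕ) (w w' : List Letter) : Prop :=
  wordDegree (d.a n) (d.b n) w = wordDegree (d.a n) (d.b n) w' ∧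
    ∀ e, ∀ᶠ j in atTop, ∀ p,
      levelAct d H (n + j) e (subst^[j] w) p = levelAct d H (n + j) e (subst^[j] w') p

variable {d H} {n : ℕ}

theorem EventuallyEquiv.refl (w : List Letter) : EventuallyEquiv d H n w w :=
  ⟨rfl, fun _ => .of_forall fun _ _ => rfl⟩

theorem EventuallyEquiv.symm {w w' : List Letter} (h : EventuallyEquiv d H n w w') :
    EventuallyEquiv d H n w' w :=
  ⟨h.1.symm, fun e => (h.2 e).mono fun _ hj p => (hj p).symm⟩

theorem EventuallyEquiv.trans {w w' w'' : List Letter} (h : EventuallyEquiv d H n w w')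
    (h' : EventuallyEquiv d H n w' w'') : EventuallyEquiv d H n w w'' :=
  ⟨h.1.trans h'.1, fun e => ((h.2 e).and (h'.2 e)).mono fun _ hj p => (hj.1 p).trans (hj.2 p)⟩

/-- The right factors start at a position fixed by the degree of the left ones. Equality of degrees
makes it common to both sides, and invariance under substitution makes it independent of the level.
-/
theorem EventuallyEquiv.append {w w' v v' : List Letter} (h : EventuallyEquiv d H n w w')
    (h' : EventuallyEquiv d H n v v') : EventuallyEquiv d H n (w ++ v) (w' ++ v') := by
  refine ⟨by rw [wordDegree_append, wordDegree_append, h.1, h'.1], fun e => ?_⟩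
  filter_upwards [h.2 e, h'.2 (e + wordDegree (d.a n) (d.b n) w)] with j h1 h2 p
  have h3 := h2 p
  simp only [levelAct] at h1 h3 ⊢
  rw [iterate_subst_append, iterate_subst_append, act_append, act_append, h1,
    wordDegree_iterate_subst, wordDegree_iterate_subst, h3, h.1]

theorem EventuallyEquiv.cons (l : Letter) {w w' : List Letter} (h : EventuallyEquiv d H n w w') :
    EventuallyEquiv d H n (l :: w) (l :: w') :=
  EventuallyEquiv.append (EventuallyEquiv.refl [l]) h

theorem eventuallyEquiv_z_zero (w : List Letter) : EventuallyEquiv d H n (.z 0 :: w) w := by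
  refine ⟨by simp [Letter.degree], fun e => .of_forall fun j p => ?_⟩
  rw [iterate_subst_z]
  simp [levelAct, act, letterAct, Letter.degree]

theorem eventuallyEquiv_z_z (k l : ℤ) (w : List Letter) :
    EventuallyEquiv d H n (.z k :: .z l :: w) (.z (l + k) :: w) := by
  refine ⟨by simp [Letter.degree], fun e => .of_forall fun j p => ?_⟩
  rw [iterate_subst_z, iterate_subst_z, iterate_subst_z]
  simp [levelAct, act, letterAct, Letter.degree, add_assoc]

/-- After substitution the rewriting happens at the very end of the word, which stays at `e + a n +
b n`. The inner boundary is at this position minus `a (n + j)` or `b (n + j)`, so it eventually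
avoids the finite set `H`. -/
theorem eventuallyEquiv_x_y : EventuallyEquiv d H n [.x, .y] [.y, .x, .z 1] := by
  refine ⟨by simp [Letter.degree, add_comm], fun e => ?_⟩
  have key : ∀ c, ∀ᶠ j in atTop, d.a (n + j) ≠ c ∧ d.b (n + j) ≠ c := fun c =>
    ((tendsto_add_atTop_nat n).eventually ((d.a_ne c).and (d.b_ne c))).mono fun j hj => by
      rwa [add_comm n j]
  -- A boundary falls on `r ∈ H` only if the letter degree is `e + a n + b n - r`, one of finitely
  -- many values.
  have key' : ∀ᶠ j in atTop, ∀ c ∈ H.image (fun r => e + d.a n + d.b n - r),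
      d.a (n + j) ≠ c ∧ d.b (n + j) ≠ c :=
    (eventually_all_finset _).2 fun c _ => key c
  filter_upwards [key'] with j hj p
  have hj' : ∀ r ∈ H, e + d.a n + d.b n - r ≠ d.a (n + j) ∧ e + d.a n + d.b n - r ≠ d.b (n + j) :=
    fun r hr => ⟨(hj _ (Finset.mem_image_of_mem _ hr)).1.symm,
      (hj _ (Finset.mem_image_of_mem _ hr)).2.symm⟩
  obtain ⟨q, h1, h2⟩ := exists_iterate_subst_x_y j
  have hdeg := wordDegree_iterate_subst d n j [.x, .y]
  rw [h1, wordDegree_append] at hdeg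
  simp only [wordDegree_cons, Letter.degree, wordDegree_nil, add_zero] at hdeg
  rw [h1, h2]
  simp only [levelAct]
  rw [act_append, act_append, act_x_y]
  simp only [isGood, decide_eq_true_eq]
  constructor <;> intro hr
  · exact (hj' _ hr).2 (by linarith)
  · exact (hj' _ hr).1 (by linarith)

/-- The word spelling the tail of a normal form. -/
def tailWord (L : List (Bool × ℤ)) : List Letter :=
  L.flatMap fun l => [if l.1 then .x else .y, .z l.2]

theorem tailWord_cons (l : Bool × ℤ) (L : List (Bool × ℤ)) :
    tailWord (l :: L) = (if l.1 then .x else .y) :: .z l.2 :: tailWord L := rfl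

theorem eventuallyEquiv_pushX (k e b : ℤ) (L : List (Bool × ℤ)) :
    EventuallyEquiv d H n (.x :: .z k :: tailWord L)
      (tailWord (pushX b (fun _ => true) e k L)) := by
  induction L generalizing k e with
  | nil => exact .refl _
  | cons l L ih =>
    obtain ⟨_ | _, k'⟩ := l
    · rw [pushX]
      split_ifs with h
      · obtain ⟨rfl, -⟩ := h
        rw [tailWord_cons, tailWord_cons]
        simp only [Bool.false_eq_true, if_false]
        refine ((eventuallyEquiv_z_zero _).cons _).trans ?_
        refine (eventuallyEquiv_x_y.append (.refl (.z k' :: tailWord L))).trans ?_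
        refine .cons .y (.trans ?_ (eventuallyEquiv_z_zero _).symm)
        exact ((eventuallyEquiv_z_z 1 k' _).cons .x).trans (ih _ _)
      · exact .refl _
    · exact .refl _

/-- The word spelling a normal form. -/
def normalWord (p : NormalForm) : List Letter := .z p.1 :: tailWord p.2

theorem eventuallyEquiv_normalWord (w : List Letter) :
    EventuallyEquiv d H n w (normalWord (fullAct w (0, []))) := by
  induction w with
  | nil => exact (eventuallyEquiv_z_zero []).symm
  | cons l w ih =>
    refine (ih.cons l).trans ?_
    rw [fullAct_cons]
    cases l with
    | x => exact (eventuallyEquiv_pushX _ _ _ _).trans (eventuallyEquiv_z_zero _).symm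
    | y => exact (eventuallyEquiv_z_zero _).symm
    | z k => exact eventuallyEquiv_z_z _ _ _

/-- Both words reduce to one full normal form by finitely many rewritings, each of which is
eventually permitted. -/
theorem eventuallyEquiv_of_evalWord_eq {w w' : List Letter} (h : evalWord w = evalWord w') :
    EventuallyEquiv d H n w w' := by
  refine (eventuallyEquiv_normalWord w).trans ?_
  rw [fullAct_eq_of_evalWord_eq h]
  exact (eventuallyEquiv_normalWord w').symm

/-! ### Cutting normal forms -/

/-- The product of the normal forms `z ^ k * ⋯` and `q`. -/
def mulNormalForm : ℤ → List (Bool × ℤ) → NormalForm → NormalForm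
  | k, [], q => (k + q.1, q.2)
  | k, l :: L, q => (k, (l.1, (mulNormalForm l.2 L q).1) :: (mulNormalForm l.2 L q).2)

/-- The degree of the tail of a normal form. -/
def tailDegree (a b : ℤ) (L : List (Bool × ℤ)) : ℤ := (L.map fun l => if l.1 then a else b).sum

@[simp] theorem tailDegree_nil (a b : ℤ) : tailDegree a b [] = 0 := rfl

@[simp] theorem tailDegree_cons (a b : ℤ) (l : Bool × ℤ) (L : List (Bool × ℤ)) :
    tailDegree a b (l :: L) = (if l.1 then a else b) + tailDegree a b L := by
  simp [tailDegree]

section Cut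

variable (a b : ℤ)

theorem tailDegree_pushX (good : ℤ → Bool) (e k : ℤ) (L : List (Bool × ℤ)) :
    tailDegree a b (pushX b good e k L) = a + tailDegree a b L := by
  induction L generalizing e k with
  | nil => simp [pushX]
  | cons l L ih =>
    obtain ⟨_ | _, k'⟩ := l
    · rw [pushX]
      split_ifs with h
      · simp [ih]; ring
      · simp
    · simp [pushX]

theorem tailDegree_act (good : ℤ → Bool) (e : ℤ) (w : List Letter) (p : NormalForm) :
    tailDegree a b (act a b good e w p).2 = wordDegree a b w + tailDegree a b p.2 := by
  induction w generalizing e with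
  | nil => simp [act]
  | cons l w ih =>
    cases l <;> simp [act, letterAct, tailDegree_pushX, ih, Letter.degree, add_assoc]

/-- An `x` that reaches the end of `L` ends at a position in `H`. Its position is then not good, so
it cannot cross into `q`. -/
theorem pushX_mulNormalForm (e k : ℤ) (L : List (Bool × ℤ)) (q : NormalForm)
    (h : e + a + tailDegree a b L ∈ H) :
    (0, pushX b (isGood H a b) e (mulNormalForm k L q).1 (mulNormalForm k L q).2) =
      mulNormalForm 0 (pushX b (isGood H a b) e k L) q := by
  induction L generalizing e k with
  | nil =>
    have hg : isGood H a b e = false := by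
      simp only [tailDegree_nil, add_zero] at h
      simp [isGood, h]
    obtain ⟨k₁, _ | ⟨⟨_ | _, k₂⟩, L₁⟩⟩ := q <;> simp [mulNormalForm, pushX, hg]
  | cons l L ih =>
    obtain ⟨_ | _, k'⟩ := l
    · simp only [mulNormalForm, pushX]
      split_ifs with hc
      · have h1 := ih (e + b) (k' + 1) (by
          simp only [tailDegree_cons, Bool.false_eq_true, if_false] at h
          convert h using 1; ring)
        have h2 : mulNormalForm (k' + 1) L q =
            ((mulNormalForm k' L q).1 + 1, (mulNormalForm k' L q).2) := by
          cases L <;> simp [mulNormalForm]; ring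
        rw [h2] at h1
        simp only [mulNormalForm, ← h1]
      · simp [mulNormalForm]
    · simp [mulNormalForm, pushX]

theorem act_eq_mulNormalForm (e : ℤ) (w : List Letter) (q : NormalForm)
    (h : e + wordDegree a b w ∈ H) :
    act a b (isGood H a b) e w q =
      mulNormalForm (act a b (isGood H a b) e w (0, [])).1
        (act a b (isGood H a b) e w (0, [])).2 q := by
  induction w generalizing e with
  | nil => simp [act, mulNormalForm]
  | cons l w ih =>
    rw [wordDegree_cons, ← add_assoc] at h
    rw [act, ih _ h]
    cases l with
    | x =>
      simp only [act, letterAct]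
      refine pushX_mulNormalForm a b e _ _ q ?_
      rw [tailDegree_act]
      simpa [Letter.degree] using h
    | y => simp [act, letterAct, mulNormalForm]
    | z k =>
      simp only [act, letterAct]
      generalize act a b (isGood H a b) (e + (Letter.z k).degree a b) w (0, []) = p
      obtain ⟨k₁, _ | ⟨l, L⟩⟩ := p <;> simp [mulNormalForm]; ring

end Cut

end Cedo

namespace Cedo

open Filter

/-! ### Degrees at infinity -/

/-- Once the absolute value increases it keeps increasing, since `|3s - t| > |s|` when `|t| < |s|`.
-/
theorem eventually_ne_of_recurrence {s : ℕ → ℤ} (hs : ∀ m, s (m + 2) = 3 * s (m + 1) - s m)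
    (h0 : s 0 ≠ 0 ∨ s 1 ≠ 0) (c : ℤ) : ∀ᶠ m in atTop, s m ≠ c := by
  obtain ⟨N, hN⟩ : ∃ N, (s N).natAbs < (s (N + 1)).natAbs := by
    -- If it never increased, it would be constant from a minimum on, and `3|s| ≤ 2|s|` would force
    -- zero there. The recurrence run backwards then makes the whole initial segment zero.
    by_contra! hle
    obtain ⟨N, hN⟩ : ∃ N, ∀ m, (s N).natAbs ≤ (s m).natAbs :=
      ⟨Function.argmin fun m => (s m).natAbs, fun m =>
        Function.argmin_le (fun m => (s m).natAbs) m⟩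
    have hlast : s N = 0 ∧ s (N + 1) = 0 := by
      have h1 := hle N
      have h2 := hle (N + 1)
      have h3 := hN (N + 1)
      have h4 := hN (N + 2)
      have h5 := hs N
      rw [show N + 1 + 1 = N + 2 from rfl] at h2
      omega
    have hz : ∀ k, s (N - k) = 0 ∧ s (N - k + 1) = 0 := by
      intro k
      induction k with
      | zero => exact hlast
      | succ k ih =>
        rcases Nat.lt_or_ge k N with hk | hk
        · have := hs (N - (k + 1))
          rw [show N - k = N - (k + 1) + 1 by omega] at ih
          rw [show N - (k + 1) + 2 = N - (k + 1) + 1 + 1 from rfl, ih.1, ih.2] at this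
          exact ⟨by omega, ih.1⟩
        · rwa [show N - (k + 1) = N - k by omega]
    have := hz N
    rw [Nat.sub_self, zero_add] at this
    exact h0.elim (fun h => h this.1) fun h => h this.2
  have hgrow : ∀ k, (s (N + k)).natAbs < (s (N + k + 1)).natAbs := by
    intro k
    induction k with
    | zero => exact hN
    | succ k ih =>
      have := hs (N + k)
      rw [show N + k + 2 = N + (k + 1) + 1 by ring] at this
      rw [show N + k + 1 = N + (k + 1) by ring] at this ih
      omega
  have hge : ∀ k : ℕ, k ≤ (s (N + k)).natAbs := by
    intro k
    induction k with
    | zero => simp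
    | succ k ih =>
      have := hgrow k
      rw [← add_assoc]
      omega
  filter_upwards [eventually_ge_atTop (N + (c.natAbs + 1))] with m hm
  obtain ⟨k, rfl⟩ := Nat.exists_eq_add_of_le hm
  have := hge (c.natAbs + 1 + k)
  rw [← add_assoc N] at this
  intro hc
  rw [hc] at this
  omega

/-- The `h ∘ δ`-degree of an element of `G`. -/
def degree (h : ℤ × ℤ →+ ℤ) (g : G) : ℤ := (h.toMultiplicative (δ g)).toAdd

theorem degree_mul (h : ℤ × ℤ →+ ℤ) (g g' : G) : degree h (g * g') = degree h g + degree h g' := by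
  simp [degree]

theorem degree_inv (h : ℤ × ℤ →+ ℤ) (g : G) : degree h g⁻¹ = -degree h g := by
  simp [degree]

theorem degree_zpow (h : ℤ × ℤ →+ ℤ) (g : G) (k : ℤ) : degree h (g ^ k) = k * degree h g := by
  simp only [degree, map_zpow, toAdd_zpow, smul_eq_mul]

theorem degree_z (h : ℤ × ℤ →+ ℤ) : degree h z = 0 := by
  simp only [z, degree_mul, degree_inv]
  ring

theorem symm_iterate_succ_σ (m : ℕ) (g : G) : σ.symm^[m + 1] (σ g) = σ.symm^[m] g := by
  rw [Function.iterate_succ_apply, MulEquiv.symm_apply_apply]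

/-- The degrees of `σ⁻ᵐ x` and `σ⁻ᵐ y` as a degree sequence. -/
def degreeSequence (h : ℤ × ℤ →+ ℤ) (hh : h ≠ 0) : DegreeSequence :=
  have ha : ∀ m, degree h (σ.symm^[m] x) =
      degree h (σ.symm^[m + 1] y) + degree h (σ.symm^[m + 1] x) := fun m => by
    rw [← symm_iterate_succ_σ m x, σ_x, iterate_map_mul, degree_mul]
  have hb : ∀ m, degree h (σ.symm^[m] y) =
      degree h (σ.symm^[m + 1] y) + degree h (σ.symm^[m + 1] x) +
        degree h (σ.symm^[m + 1] y) := fun m => by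
    rw [← symm_iterate_succ_σ m y, σ_y, iterate_map_mul, iterate_map_mul, degree_mul, degree_mul]
  have hne : degree h x ≠ 0 ∨ degree h y ≠ 0 := by
    by_contra! hc
    refine hh (AddMonoidHom.ext fun ⟨i, j⟩ => ?_)
    have hx : h (1, 0) = 0 := by simpa [degree, δ, x] using hc.1
    have hy : h (0, 1) = 0 := by simpa [degree, δ, y] using hc.2
    have : ((i, j) : ℤ × ℤ) = i • (1, 0) + j • (0, 1) := by simp
    rw [this, map_add, map_zsmul, map_zsmul, hx, hy]
    simp
  { a := fun m => degree h (σ.symm^[m] x)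
    b := fun m => degree h (σ.symm^[m] y)
    a_eq := ha
    b_eq := hb
    a_ne := by
      refine eventually_ne_of_recurrence (fun m => ?_) ?_
      · have h1 := ha m; have h2 := hb m; have h3 := ha (m + 1); have h4 := hb (m + 1)
        rw [show m + 2 = m + 1 + 1 from rfl]; omega
      · by_contra! hc
        have h1 := ha 0; have h2 := hb 0
        simp only [Function.iterate_zero, id, zero_add] at h1 h2 hc
        omega
    b_ne := by
      refine eventually_ne_of_recurrence (fun m => ?_) ?_
      · have h1 := ha m; have h2 := hb m; have h3 := ha (m + 1); have h4 := hb (m + 1)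
        rw [show m + 2 = m + 1 + 1 from rfl]; omega
      · by_contra! hc
        have h1 := ha 0; have h2 := hb 0
        simp only [Function.iterate_zero, id, zero_add] at h1 h2 hc
        omega }

theorem iterate_symm_zpow_z (m : ℕ) (k : ℤ) : σ.symm^[m] (z ^ k) = z ^ k :=
  Function.iterate_fixed (by rw [MulEquiv.symm_apply_eq, σ_zpow_z]) m

/-- Positions measured at level `m` are therefore degrees of the original elements, whatever the
level. -/
theorem degree_symm_iterate_evalWord (h : ℤ × ℤ →+ ℤ) (hh : h ≠ 0) (m : ℕ) (w : List Letter) :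
    degree h (σ.symm^[m] (evalWord w)) =
      wordDegree ((degreeSequence h hh).a m) ((degreeSequence h hh).b m) w := by
  induction w with
  | nil => rw [evalWord_nil, iterate_map_one]; simp [degree]
  | cons l w ih =>
    rw [evalWord_cons, iterate_map_mul, degree_mul, ih, wordDegree_cons]
    congr 1
    cases l with
    | x => rfl
    | y => rfl
    | z k => rw [Letter.eval, iterate_symm_zpow_z, degree_zpow, degree_z]; simp [Letter.degree]

/-! ### Exponents of `z` -/

/-- All exponents of `z` in the word lie in `C`. -/
def WordExponents (C : AddSubmonoid ℤ) (w : List Letter) : Prop := ∀ k, Letter.z k ∈ w → k ∈ C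

/-- All exponents of `z` in the normal form satisfy `P`. -/
def NormalFormExponents (P : ℤ → Prop) (p : NormalForm) : Prop := P p.1 ∧ ∀ l ∈ p.2, P l.2

variable {C : AddSubmonoid ℤ}

/-- Rewriting changes exponents only by adding `1` or creating `0`, so no new negative exponents
arise. -/
theorem exponents_pushX (hC : 1 ∈ C) (b : ℤ) (good : ℤ → Bool) (e k : ℤ)
    (L : List (Bool × ℤ)) (h : NormalFormExponents (· ∈ C) (k, L)) :
    ∀ l ∈ pushX b good e k L, l.2 ∈ C := by
  induction L generalizing e k with
  | nil => simpa [pushX] using h.1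
  | cons l L ih =>
    obtain ⟨hk, hL⟩ := h
    rw [List.forall_mem_cons] at hL
    obtain ⟨_ | _, k'⟩ := l
    · rw [pushX]
      split_ifs with hc
      · rw [List.forall_mem_cons]
        exact ⟨zero_mem C, ih _ _ ⟨add_mem hL.1 hC, hL.2⟩⟩
      · rw [List.forall_mem_cons, List.forall_mem_cons]
        exact ⟨hk, hL⟩
    · rw [pushX, List.forall_mem_cons, List.forall_mem_cons]
      exact ⟨hk, hL⟩

theorem exponents_act (hC : 1 ∈ C) (a b : ℤ) (good : ℤ → Bool) (e : ℤ) (w : List Letter)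
    (hw : WordExponents C w) (p : NormalForm) (hp : NormalFormExponents (· ∈ C) p) :
    NormalFormExponents (· ∈ C) (act a b good e w p) := by
  induction w generalizing e with
  | nil => exact hp
  | cons l w ih =>
    have h1 := ih (e + l.degree a b) fun k hk => hw k (List.mem_cons_of_mem _ hk)
    rw [act]
    cases l with
    | x => exact ⟨zero_mem C, exponents_pushX hC _ _ _ _ _ h1⟩
    | y => exact ⟨zero_mem C, List.forall_mem_cons.2 h1⟩
    | z k => exact ⟨add_mem h1.1 (hw k List.mem_cons_self), h1.2⟩

theorem WordExponents.append {w w' : List Letter} (h : WordExponents C w)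
    (h' : WordExponents C w') : WordExponents C (w ++ w') := fun k hk =>
  (List.mem_append.1 hk).elim (h k) (h' k)

theorem WordExponents.iterate_subst {w : List Letter} (h : WordExponents C w) (j : ℕ) :
    WordExponents C (subst^[j] w) := by
  induction j with
  | zero => exact h
  | succ j ih =>
    rw [Function.iterate_succ_apply']
    intro k hk
    obtain ⟨l, hl, hkl⟩ := List.mem_flatMap.1 hk
    cases l with
    | x => simp at hkl
    | y => simp at hkl
    | z k' =>
      simp only [List.mem_singleton, Letter.z.injEq] at hkl
      exact hkl ▸ ih k' hl

/-! ### Encoding normal forms in a free monoid -/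

/-- The element of the free monoid on `z` (`none`), `x` and `y` (`some`) obtained from the normal
form `z ^ k * ⋯` by adding `A` to all exponents but the first and then `r` to the last. -/
def encode (A r : ℤ) : ℤ → List (Bool × ℤ) → FreeMonoid (Option Bool)
  | k, [] => FreeMonoid.of none ^ (k + r).toNat
  | k, l :: L => FreeMonoid.of none ^ k.toNat * FreeMonoid.of (some l.1) * encode A r (l.2 + A) L

/-- At the seam the exponents `k + B` and `k' + B` add up to `k + k' + 2B`, the merged exponent with
the usual shift. Both summands are nonnegative, so `toNat` is additive on them. -/
theorem encode_mul {B : ℤ} (p q : NormalForm)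
    (hp : NormalFormExponents (-B ≤ ·) p) (hq : NormalFormExponents (-B ≤ ·) q) :
    encode (2 * B) (-B) (p.1 + 2 * B) p.2 * encode (2 * B) 0 (q.1 + B) q.2 =
      encode (2 * B) 0 ((mulNormalForm p.1 p.2 q).1 + 2 * B) (mulNormalForm p.1 p.2 q).2 := by
  obtain ⟨k, L⟩ := p
  induction L generalizing k with
  | nil =>
    have h1 := hp.1
    have h2 := hq.1
    simp only at h1 h2
    obtain ⟨k', _ | ⟨l, L'⟩⟩ := q
    · simp only [encode, mulNormalForm, ← pow_add]
      congr 1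
      omega
    · simp only [encode, mulNormalForm, ← mul_assoc, ← pow_add]
      congr 3
      simp only at h2
      omega
  | cons l L ih =>
    have := ih l.2 ⟨(List.forall_mem_cons.1 hp.2).1, (List.forall_mem_cons.1 hp.2).2⟩
    simp only [encode, mulNormalForm, mul_assoc] at this ⊢
    rw [this]

/-- The homomorphism to `G` sending the letter `z` to `z` and the letters `x`, `y` to
`x * z ^ (-A)`, `y * z ^ (-A)`. -/
def decode (A : ℤ) : FreeMonoid (Option Bool) →* G :=
  FreeMonoid.lift fun l => l.elim z fun l => gen l * z ^ (-A)

/-- The bounds on `r` and `s` keep every encoded exponent nonnegative, so `toNat` loses nothing. The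
shift after each letter cancels the factor `z ^ (-(2 * B))` in its decoding. -/
theorem decode_encode {B r s : ℤ} (hB : 0 ≤ B) (hs : B ≤ s) (hr : -B ≤ r) (hsr : B ≤ s + r)
    (p : NormalForm) (hp : NormalFormExponents (-B ≤ ·) p) :
    decode (2 * B) (encode (2 * B) r (p.1 + s) p.2) = z ^ s * evalNormalForm p * z ^ r := by
  obtain ⟨k, L⟩ := p
  induction L generalizing k s with
  | nil =>
    have h1 := hp.1
    simp only at h1
    simp only [encode, map_pow, decode, FreeMonoid.lift_eval_of, Option.elim, evalNormalForm,
      evalTail_nil, mul_one]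
    rw [← zpow_natCast, Int.toNat_of_nonneg (by omega), zpow_add, zpow_add, ← zpow_add, add_comm k,
      zpow_add]
  | cons l L ih =>
    have h1 := hp.1
    simp only at h1
    have := ih (s := 2 * B) (by omega) (by omega) l.2
      ⟨(List.forall_mem_cons.1 hp.2).1, (List.forall_mem_cons.1 hp.2).2⟩
    simp only [encode, map_mul, map_pow, this]
    simp only [decode, FreeMonoid.lift_eval_of, Option.elim, evalNormalForm, evalTail_cons]
    rw [← zpow_natCast, Int.toNat_of_nonneg (by omega), add_comm k, zpow_add, zpow_neg]
    simp only [mul_assoc, inv_mul_cancel_left]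

end Cedo

namespace Cedo

open Filter

/-! ### Monoids of values of words -/

/-- The submonoid `N` of `G` consists of the values of words with exponents of `z` in `C`, and
lower bounds on exponents in `C` can be taken to be negatives of units of `C`. -/
structure IsWordMonoid (N : Submonoid G) (C : AddSubmonoid ℤ) : Prop where
  mem_iff : ∀ g, g ∈ N ↔ ∃ w, WordExponents C w ∧ evalWord w = g
  one_mem : 1 ∈ C
  exists_bound : ∀ B : ℤ, ∃ A : ℤ, 0 ≤ A ∧ -A ∈ C ∧ ∀ k ∈ C, -B ≤ k → -A ≤ k

theorem exists_word_of_mem_closure {S : Set G} {C : AddSubmonoid ℤ}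
    (hS : ∀ g ∈ S, ∃ w, WordExponents C w ∧ evalWord w = g) {g : G}
    (hg : g ∈ Submonoid.closure S) : ∃ w, WordExponents C w ∧ evalWord w = g := by
  induction hg using Submonoid.closure_induction with
  | mem g hg => exact hS g hg
  | one => exact ⟨[], by simp [WordExponents], rfl⟩
  | mul g g' _ _ h h' =>
    obtain ⟨w, hw, rfl⟩ := h
    obtain ⟨w', hw', rfl⟩ := h'
    exact ⟨w ++ w', hw.append hw', evalWord_append w w'⟩

theorem evalWord_mem {N : Submonoid G} {C : AddSubmonoid ℤ} (hx : x ∈ N) (hy : y ∈ N)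
    (hz : ∀ k ∈ C, z ^ k ∈ N) {w : List Letter} (hw : WordExponents C w) : evalWord w ∈ N := by
  refine Submonoid.list_prod_mem _ fun g hg => ?_
  obtain ⟨l, hl, rfl⟩ := List.mem_map.1 hg
  cases l with
  | x => exact hx
  | y => exact hy
  | z k => exact hz k (hw k hl)

theorem isWordMonoid_M₀ : IsWordMonoid M₀ (AddSubmonoid.nonneg ℤ) where
  mem_iff g := by
    constructor
    · refine exists_word_of_mem_closure ?_
      rintro _ (rfl | rfl | rfl)
      · exact ⟨[.x], by simp [WordExponents], by simp [Letter.eval]⟩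
      · exact ⟨[.y], by simp [WordExponents], by simp [Letter.eval]⟩
      · exact ⟨[.z 1], by simp [WordExponents], by simp [Letter.eval]⟩
    · rintro ⟨w, hw, rfl⟩
      refine evalWord_mem (Submonoid.subset_closure (by simp))
        (Submonoid.subset_closure (by simp)) (fun k hk => ?_) hw
      lift k to ℕ using hk
      rw [zpow_natCast]
      exact pow_mem (Submonoid.subset_closure (by simp)) k
  one_mem := by simp
  exists_bound _ := ⟨0, le_rfl, by simp, fun k hk _ => by simpa using hk⟩

theorem isWordMonoid_M₁ : IsWordMonoid M₁ ⊤ where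
  mem_iff g := by
    constructor
    · refine exists_word_of_mem_closure ?_
      rintro _ (rfl | rfl | rfl | rfl)
      · exact ⟨[.x], by simp [WordExponents], by simp [Letter.eval]⟩
      · exact ⟨[.y], by simp [WordExponents], by simp [Letter.eval]⟩
      · exact ⟨[.z 1], by simp [WordExponents], by simp [Letter.eval]⟩
      · exact ⟨[.z (-1)], by simp [WordExponents], by simp [Letter.eval]⟩
    · rintro ⟨w, hw, rfl⟩
      refine evalWord_mem (C := ⊤) (Submonoid.subset_closure (by simp))
        (Submonoid.subset_closure (by simp)) (fun k _ => ?_) hw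
      obtain ⟨n, rfl | rfl⟩ := k.eq_nat_or_neg
      · rw [zpow_natCast]
        exact pow_mem (Submonoid.subset_closure (by simp)) n
      · rw [zpow_neg, zpow_natCast, ← inv_pow]
        exact pow_mem (Submonoid.subset_closure (by simp)) n
  one_mem := trivial
  exists_bound B := ⟨max B 0, le_max_right _ _, trivial, fun k _ hk => by omega⟩

/-! ### Compatible normal forms and encodings of finitely many elements -/

section Lift

variable {N : Submonoid G} (hN : ∀ a ∈ N, σ a ∈ N) {C : AddSubmonoid ℤ}

/-- Here `nf e g` is the partial normal form of `σ^m g` started at position `e`. The level is raised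
twice: to bring all of `Ω` into `N`, then to make the finitely many product identities hold. -/
theorem exists_normalForms (hNC : IsWordMonoid N C)
    (h : ℤ × ℤ →+ ℤ) (hh : h ≠ 0) (H : Finset ℤ) (Ω : Finset G) (hΩ : ∀ g ∈ Ω, g ∈ limitMonoid N hN) :
    ∃ (m : ℕ) (nf : ℤ → G → NormalForm),
      (∀ e, ∀ g ∈ Ω, evalNormalForm (nf e g) = σ^[m] g ∧ NormalFormExponents (· ∈ C) (nf e g)) ∧
      ∀ g ∈ Ω, ∀ g' ∈ Ω, g * g' ∈ Ω → degree h g ∈ H →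
        nf 0 (g * g') = mulNormalForm (nf 0 g).1 (nf 0 g).2 (nf (degree h g) g') := by
  obtain ⟨n, hn⟩ : ∃ n, ∀ g ∈ Ω, σ^[n] g ∈ N := by
    have h1 : ∀ g : Ω, ∃ n, σ^[n] (g : G) ∈ N := fun g => hΩ g g.2
    choose n hn using h1
    refine ⟨Finset.univ.sup n, fun g hg => ?_⟩
    exact iterate_mem hN (Finset.le_sup (Finset.mem_univ ⟨g, hg⟩)) (hn ⟨g, hg⟩)
  have h2 : ∀ g, ∃ w, g ∈ Ω → WordExponents C w ∧ evalWord w = σ^[n] g := by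
    intro g
    by_cases hg : g ∈ Ω
    · obtain ⟨w, hw⟩ := (hNC.mem_iff _).1 (hn g hg)
      exact ⟨w, fun _ => hw⟩
    · exact ⟨[], fun hg' => (hg hg').elim⟩
  choose w hw using h2
  set d := degreeSequence h hh with hd
  have h3 : ∀ᶠ j in atTop, ∀ g ∈ Ω, ∀ g' ∈ Ω, g * g' ∈ Ω → ∀ p,
      levelAct d H (n + j) 0 (subst^[j] (w g ++ w g')) p =
        levelAct d H (n + j) 0 (subst^[j] (w (g * g'))) p := by
    refine (eventually_all_finset _).2 fun g hg => (eventually_all_finset _).2 fun g' hg' =>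
      eventually_imp_distrib_left.2 fun hgg' => (eventuallyEquiv_of_evalWord_eq ?_).2 0
    rw [evalWord_append, (hw g hg).2, (hw g' hg').2, (hw _ hgg').2, iterate_map_mul]
  obtain ⟨j, hj⟩ := h3.exists
  have hdeg : ∀ g ∈ Ω,
      wordDegree (d.a (n + j)) (d.b (n + j)) (subst^[j] (w g)) = degree h g := by
    intro g hg
    rw [hd, ← degree_symm_iterate_evalWord, evalWord_iterate_subst, (hw g hg).2,
      ← Function.iterate_add_apply, add_comm j n]
    congr 1
    exact Function.LeftInverse.iterate σ.symm_apply_apply (n + j) g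
  refine ⟨n + j, fun e g => levelAct d H (n + j) e (subst^[j] (w g)) (0, []), ?_, ?_⟩
  · intro e g hg
    refine ⟨?_, exponents_act hNC.one_mem _ _ _ _ _ ((hw g hg).1.iterate_subst j) _
      ⟨zero_mem C, by simp⟩⟩
    simp only [levelAct]
    rw [evalNormalForm_act, evalWord_iterate_subst, (hw g hg).2,
      ← Function.iterate_add_apply, add_comm j n]
    simp [evalNormalForm]
  · intro g hg g' hg' hgg' hgH
    simp only
    rw [← hj g hg g' hg' hgg', iterate_subst_append]
    simp only [levelAct]
    rw [act_append, hdeg g hg, zero_add]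
    exact act_eq_mulNormalForm _ _ _ _ _ (by rwa [hdeg g hg, zero_add])

theorem exists_exponents_bound (S : Finset NormalForm) :
    ∃ B : ℤ, ∀ p ∈ S, NormalFormExponents (-B ≤ ·) p := by
  classical
  obtain ⟨B, hB⟩ := (S.biUnion fun p => insert p.1 (p.2.map Prod.snd).toFinset).bddBelow
  refine ⟨-B, fun p hp => ⟨?_, fun l hl => ?_⟩⟩ <;> rw [neg_neg]
  · exact hB (Finset.mem_coe.2 (Finset.mem_biUnion.2 ⟨p, hp, Finset.mem_insert_self _ _⟩))
  · refine hB (Finset.mem_coe.2 (Finset.mem_biUnion.2 ⟨p, hp, Finset.mem_insert_of_mem ?_⟩))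
    rw [List.mem_toFinset]
    exact List.mem_map_of_mem hl

/-- With `ζ = z ^ B`, the factors become `ζ² g ζ⁻¹` and `ζ g'`, with product `ζ² g g'`; this leaves
room for negative exponents on both sides of the seam. `U`, `V` and `W` are mere functions; only `Φ`
is a homomorphism. -/
theorem exists_encodings (hNC : IsWordMonoid N C)
    (h : ℤ × ℤ →+ ℤ) (hh : h ≠ 0) (H : Finset ℤ) (Ω : Finset (limitMonoid N hN)) :
    ∃ (Φ : FreeMonoid (Option Bool) →* limitMonoid N hN) (ζ : (limitMonoid N hN)ˣ)
      (U W : limitMonoid N hN → FreeMonoid (Option Bool))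
      (V : ℤ → limitMonoid N hN → FreeMonoid (Option Bool)),
      hδ h (limitMonoid N hN) ζ = 1 ∧
      (∀ g ∈ Ω, Φ (U g) = ζ * ζ * g * (ζ⁻¹ : (limitMonoid N hN)ˣ)) ∧
      (∀ e ∈ H, ∀ g ∈ Ω, Φ (V e g) = ζ * g) ∧
      ∀ g ∈ Ω, ∀ g' ∈ Ω, g * g' ∈ Ω → (hδ h (limitMonoid N hN) g).toAdd ∈ H →
        U g * V (hδ h (limitMonoid N hN) g).toAdd g' = W (g * g') := by
  classical
  obtain ⟨m, nf, hnf, hmul⟩ := exists_normalForms hN hNC h hh H (Ω.map (Function.Embedding.subtype _))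
    (fun g hg => by obtain ⟨g, _, rfl⟩ := Finset.mem_map.1 hg; exact g.2)
  have hΩ : ∀ {g}, g ∈ Ω → (g : G) ∈ Ω.map (Function.Embedding.subtype _) := fun {g} hg =>
    Finset.mem_map_of_mem (Function.Embedding.subtype _) hg
  obtain ⟨B₀, hB₀⟩ := exists_exponents_bound
    ((insert 0 H).biUnion fun e => Ω.image fun g : limitMonoid N hN => nf e g)
  -- The bound must have `-B ∈ C`, so that `z ^ B` is a unit and the letters decode into `N`.
  obtain ⟨B, hB, hBC, hBle⟩ := hNC.exists_bound B₀
  have hexp : ∀ e ∈ insert 0 H, ∀ g ∈ Ω, NormalFormExponents (-B ≤ ·) (nf e g) := by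
    intro e he g hg
    have h1 := hB₀ (nf e g) (Finset.mem_biUnion.2 ⟨e, he, Finset.mem_image_of_mem _ hg⟩)
    have h2 := (hnf e g (hΩ hg)).2
    exact ⟨hBle _ h2.1 h1.1, fun l hl => hBle _ (h2.2 l hl) (h1.2 l hl)⟩
  have hzmem : ∀ k ∈ C, z ^ k ∈ N := fun k hk =>
    (hNC.mem_iff _).2 ⟨[.z k], by simpa [WordExponents] using hk, by simp [Letter.eval]⟩
  have hgen : ∀ l, gen l ∈ N := fun l => (hNC.mem_iff _).2 ⟨[if l then .x else .y],
    by cases l <;> simp [WordExponents], by cases l <;> simp [Letter.eval, gen]⟩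
  have hBC' : B ∈ C := by
    lift B to ℕ using hB
    simpa using nsmul_mem hNC.one_mem B
  have hinv : ∀ g : G, σ^[m] (σ.symm^[m] g) = g :=
    Function.LeftInverse.iterate σ.apply_symm_apply m
  have hinv' : ∀ g : G, σ.symm^[m] (σ^[m] g) = g :=
    Function.LeftInverse.iterate σ.symm_apply_apply m
  have hdec : ∀ l, decode (2 * B) (FreeMonoid.of l) ∈ N := by
    intro l
    rw [decode, FreeMonoid.lift_eval_of]
    cases l with
    | none => simpa using hzmem 1 hNC.one_mem
    | some l =>
      refine mul_mem (hgen l) (hzmem _ ?_)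
      rw [show -(2 * B) = -B + -B by ring]
      exact add_mem hBC hBC
  -- Applying `σ^m` returns these values to `N`, so they lie in the limit monoid.
  let Φ : FreeMonoid (Option Bool) →* limitMonoid N hN := FreeMonoid.lift fun l =>
    ⟨σ.symm^[m] (decode (2 * B) (FreeMonoid.of l)), m, by rw [hinv]; exact hdec l⟩
  have hΦ : ∀ w, (Φ w : G) = σ.symm^[m] (decode (2 * B) w) := by
    intro w
    induction w using FreeMonoid.inductionOn' with
    | one => rw [map_one, map_one, iterate_map_one]; rfl
    | of_mul l w ih =>
      rw [map_mul, map_mul, iterate_map_mul, Submonoid.coe_mul, ih]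
      simp [Φ]
  let ζ : (limitMonoid N hN)ˣ :=
    { val := ⟨z ^ B, 0, hzmem _ hBC'⟩
      inv := ⟨z ^ (-B), 0, hzmem _ hBC⟩
      val_inv := Subtype.ext (by simp)
      inv_val := Subtype.ext (by simp) }
  refine ⟨Φ, ζ, fun g => encode (2 * B) (-B) ((nf 0 g).1 + 2 * B) (nf 0 g).2,
    fun g => encode (2 * B) 0 ((nf 0 g).1 + 2 * B) (nf 0 g).2,
    fun e g => encode (2 * B) 0 ((nf e g).1 + B) (nf e g).2, ?_, ?_, ?_, ?_⟩
  · have h1 : degree h (z ^ B) = 0 := by rw [degree_zpow, degree_z, mul_zero]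
    exact Multiplicative.toAdd.injective h1
  · intro g hg
    refine Subtype.ext ?_
    rw [hΦ, decode_encode hB (by omega) (by omega) (by omega) _ (hexp 0 (by simp) g hg),
      (hnf 0 g (hΩ hg)).1, iterate_map_mul, iterate_map_mul, hinv', iterate_symm_zpow_z,
      iterate_symm_zpow_z, two_mul, zpow_add]
    rfl
  · intro e he g hg
    refine Subtype.ext ?_
    rw [hΦ, decode_encode hB le_rfl (by omega) (by omega) _
      (hexp e (Finset.mem_insert_of_mem he) g hg), (hnf e g (hΩ hg)).1, iterate_map_mul,
      iterate_map_mul, hinv', iterate_symm_zpow_z, iterate_symm_zpow_z, zpow_zero, mul_one]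
    rfl
  · intro g hg g' hg' hgg' hgH
    have h1 := hmul g (hΩ hg) g' (hΩ hg') (by simpa using hΩ hgg') hgH
    change encode _ _ _ _ * encode _ _ ((nf (degree h g) g').1 + B) (nf (degree h g) g').2 =
      encode _ _ ((nf 0 (g * g' : G)).1 + 2 * B) (nf 0 (g * g' : G)).2
    rw [h1]
    exact encode_mul _ _ (hexp 0 (by simp) g hg) (hexp _ (Finset.mem_insert_of_mem hgH) g' hg')

end Lift

end Cedo

/-! ### Transfer of relations and trivializations along maps -/

namespace GradedSemifir

open Matrix

/-- A relation is trivialized homogeneously as soon as, up to units of degree zero, it is the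
image of a homogeneously trivialized relation. -/
theorem exists_trivializes_of_map {A R R' S S' : Type*} [AddGroup A] [Ring R] [Ring R']
    [SetLike S R] [AddSubmonoidClass S R] [SetLike S' R'] {𝒜 : A → S} [SetLike.GradedMonoid 𝒜]
    {ℬ : A → S'} (φ : R' →+* R) (hφ : ∀ a, ∀ r ∈ ℬ a, φ r ∈ 𝒜 a) {m : ℕ} {α : Fin m → A}
    {u v : Fin m → R} {u' v' : Fin m → R'} (ξ ζ : Rˣ) (hζ : (ζ : R) ∈ 𝒜 0)
    (hζ' : ((ζ⁻¹ : Rˣ) : R) ∈ 𝒜 0) (hu : ∀ i, φ (u' i) = ξ * u i * (ζ⁻¹ : Rˣ))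
    (hv : ∀ i, φ (v' i) = ζ * v i)
    (h : ∃ T : (Matrix (Fin m) (Fin m) R')ˣ,
      (∀ i j, (T : Matrix (Fin m) (Fin m) R') i j ∈ ℬ (-α i + α j)) ∧ Trivializes T u' v') :
    ∃ T : (Matrix (Fin m) (Fin m) R)ˣ,
      (∀ i j, (T : Matrix (Fin m) (Fin m) R) i j ∈ 𝒜 (-α i + α j)) ∧ Trivializes T u v := by
  obtain ⟨T, hT, htriv⟩ := h
  let T₀ : (Matrix (Fin m) (Fin m) R)ˣ := Units.map (φ.mapMatrix : _ →+* _).toMonoidHom T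
  let Z : (Matrix (Fin m) (Fin m) R)ˣ := Units.map (Matrix.scalar (Fin m)).toMonoidHom ζ
  have hZ : (Z : Matrix (Fin m) (Fin m) R) = Matrix.diagonal fun _ => (ζ : R) := rfl
  have hZ' : ((Z⁻¹ : (Matrix (Fin m) (Fin m) R)ˣ) : Matrix (Fin m) (Fin m) R) =
      Matrix.diagonal fun _ => ((ζ⁻¹ : Rˣ) : R) := rfl
  have hT₀ : (T₀ : Matrix (Fin m) (Fin m) R) = (T : Matrix (Fin m) (Fin m) R').map φ := rfl
  have hT₀' : ((T₀⁻¹ : (Matrix (Fin m) (Fin m) R)ˣ) : Matrix (Fin m) (Fin m) R) =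
      ((T⁻¹ : (Matrix (Fin m) (Fin m) R')ˣ) : Matrix (Fin m) (Fin m) R').map φ := rfl
  -- Conjugation by `ζ` undoes the twist between the two factors; the common left factor `ξ` does
  -- not affect which entries vanish.
  refine ⟨Z⁻¹ * T₀ * Z, fun i j => ?_, fun i => ?_⟩
  · rw [Units.val_mul, Units.val_mul, hZ, hZ', hT₀, Matrix.mul_diagonal, Matrix.diagonal_mul,
      Matrix.map_apply]
    have := SetLike.mul_mem_graded (SetLike.mul_mem_graded hζ' (hφ _ _ (hT i j))) hζ
    rwa [zero_add, add_zero] at this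
  · refine (htriv i).imp (fun h0 => ?_) fun h0 => ?_
    · have h1 : (ξ : R) * (u ᵥ* ((Z⁻¹ * T₀ : (Matrix (Fin m) (Fin m) R)ˣ) :
          Matrix (Fin m) (Fin m) R)) i = 0 := by
        rw [← map_zero φ, ← h0]
        simp only [Units.val_mul, hZ', hT₀, Matrix.vecMul, dotProduct, Matrix.diagonal_mul,
          Matrix.map_apply, map_sum, map_mul, hu, Finset.mul_sum, mul_assoc]
      rw [Units.mul_right_eq_zero] at h1
      rw [Units.val_mul, ← Matrix.vecMul_vecMul, hZ, Matrix.vecMul_diagonal, h1, zero_mul]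
    · have h1 : (((T₀⁻¹ * Z : (Matrix (Fin m) (Fin m) R)ˣ) :
          Matrix (Fin m) (Fin m) R) *ᵥ v) i = 0 := by
        rw [← map_zero φ, ← h0]
        simp only [Units.val_mul, hZ, hT₀', Matrix.mulVec, dotProduct, Matrix.mul_diagonal,
          Matrix.map_apply, map_sum, map_mul, hv, mul_assoc]
      rw [_root_.mul_inv_rev, _root_.mul_inv_rev, inv_inv, Units.val_mul,
        ← Matrix.mulVec_mulVec, hZ', Matrix.mulVec_diagonal, h1, mul_zero]

section MapDomain

variable {D M M' A : Type*} [Ring D] [Monoid M] [Monoid M'] [AddGroup A]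

theorem mapDomain_eq_sum {D M M' : Type*} [Ring D] (g : M → M') (p : MonoidAlgebra D M) :
    p.mapDomain g = ∑ c ∈ p.coeff.support, MonoidAlgebra.single (g c) (p.coeff c) := by
  conv_lhs => rw [← MonoidAlgebra.sum_coeff_single p, Finsupp.sum]
  exact (map_sum (⟨⟨MonoidAlgebra.mapDomain g, MonoidAlgebra.mapDomain_zero g⟩,
    MonoidAlgebra.mapDomain_add g⟩ : MonoidAlgebra D M →+ MonoidAlgebra D M') _ _).trans
    (by simp [MonoidAlgebra.mapDomain_single])

theorem mapDomain_mem_component (f : M →* Multiplicative A) (f' : M' →* Multiplicative A)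
    (g : M → M') {a : A} {p : MonoidAlgebra D M} (hp : p ∈ component D f a)
    (hg : ∀ c ∈ p.coeff.support, f' (g c) = f c) : p.mapDomain g ∈ component D f' a := by
  rw [mapDomain_eq_sum]
  refine sum_mem fun c hc => ?_
  have := single_mem_component (D := D) f' (g c) (p.coeff c)
  rwa [hg c hc, (mem_component_iff f a p).1 hp c hc] at this

/-- Multiplicativity is needed only on the supports, so arbitrary functions suffice; they need not
be injective. -/
theorem mapDomain_mul_mapDomain (g g' k : M → M') (p q : MonoidAlgebra D M)
    (h : ∀ c ∈ p.coeff.support, ∀ c' ∈ q.coeff.support, g c * g' c' = k (c * c')) :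
    p.mapDomain g * q.mapDomain g' = (p * q).mapDomain k := by
  conv_rhs => rw [← MonoidAlgebra.sum_coeff_single p, ← MonoidAlgebra.sum_coeff_single q,
    Finsupp.sum, Finsupp.sum, Finset.sum_mul_sum]
  rw [mapDomain_eq_sum, mapDomain_eq_sum, Finset.sum_mul_sum]
  let K : MonoidAlgebra D M →+ MonoidAlgebra D M' :=
    ⟨⟨MonoidAlgebra.mapDomain k, MonoidAlgebra.mapDomain_zero k⟩, MonoidAlgebra.mapDomain_add k⟩
  change _ = K _
  rw [map_sum]
  refine Finset.sum_congr rfl fun c hc => ?_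
  rw [map_sum]
  refine Finset.sum_congr rfl fun c' hc' => ?_
  change _ = MonoidAlgebra.mapDomain k _
  rw [MonoidAlgebra.single_mul_single, MonoidAlgebra.single_mul_single,
    MonoidAlgebra.mapDomain_single, h c hc c' hc']

end MapDomain

end GradedSemifir

/-! ### Lifting a relation to the free algebra -/

namespace Cedo

open GradedSemifir

open scoped Pointwise

theorem isHomogeneousSemifir_limitMonoid (D : Type*) [DivisionRing D] {N : Submonoid G}
    (hN : ∀ a ∈ N, σ a ∈ N) {C : AddSubmonoid ℤ} (hNC : IsWordMonoid N C) (h : ℤ × ℤ →+ ℤ)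
    (hh : h ≠ 0) : IsHomogeneousSemifir (component D (hδ h (limitMonoid N hN))) := by
  classical
  intro n m _ α β u v huv
  set f := hδ h (limitMonoid N hN) with hf
  let Ω₁ : Finset (limitMonoid N hN) :=
    Finset.univ.biUnion fun i => (u i).coeff.support ∪ (v i).coeff.support
  -- Products are included because their normal forms are compared with those of the factors.
  let Ω : Finset (limitMonoid N hN) := Ω₁ ∪ Ω₁ * Ω₁
  have hu₁ : ∀ i, ∀ c ∈ (u i).coeff.support, c ∈ Ω₁ := fun i c hc =>
    Finset.mem_biUnion.2 ⟨i, Finset.mem_univ i, Finset.mem_union_left _ hc⟩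
  have hv₁ : ∀ i, ∀ c ∈ (v i).coeff.support, c ∈ Ω₁ := fun i c hc =>
    Finset.mem_biUnion.2 ⟨i, Finset.mem_univ i, Finset.mem_union_right _ hc⟩
  have hΩ₁ : ∀ {c}, c ∈ Ω₁ → c ∈ Ω := fun {c} hc => Finset.mem_union_left _ hc
  -- The seam in `u i * v i` is at the degree `α i` of `u i`.
  let H : Finset ℤ := Finset.univ.image α
  have hα : ∀ i, α i ∈ H := fun i => Finset.mem_image_of_mem α (Finset.mem_univ i)
  obtain ⟨Φ, ζ, U, W, V, hζ, hU, hV, hUVW⟩ := exists_encodings hN hNC h hh H Ω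
  rw [← hf] at hζ hUVW
  let ι : limitMonoid N hN →* MonoidAlgebra D (limitMonoid N hN) := MonoidAlgebra.of D _
  have hζ' : f ((ζ⁻¹ : (limitMonoid N hN)ˣ) : limitMonoid N hN) = 1 := by
    have : f (ζ * (ζ⁻¹ : (limitMonoid N hN)ˣ)) = 1 := by rw [Units.mul_inv, map_one]
    rwa [map_mul, hζ, one_mul] at this
  have hdegu : ∀ i, ∀ c ∈ (u i).coeff.support, (f c).toAdd = α i := fun i =>
    (mem_component_iff f _ _).1 (huv.left_mem i)
  refine exists_trivializes_of_map (R' := MonoidAlgebra D (FreeMonoid (Option Bool)))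
    (ℬ := component D (f.comp Φ)) (MonoidAlgebra.mapDomainRingHom D Φ) ?_
    (Units.map ι (ζ * ζ)) (Units.map ι ζ) ?_ ?_ (u' := fun i => (u i).mapDomain U)
    (v' := fun i => (v i).mapDomain (V (α i))) ?_ ?_
    (isHomogeneousSemifir_freeMonoid (f.comp Φ) m m le_rfl α β _ _ ⟨?_, ?_, ?_⟩)
  · intro a r hr
    exact mapDomain_mem_component (f.comp Φ) f Φ hr fun _ _ => rfl
  · have := single_mem_component (D := D) f (ζ : limitMonoid N hN) 1
    rwa [hζ] at this
  · have := single_mem_component (D := D) f ((ζ⁻¹ : (limitMonoid N hN)ˣ) : limitMonoid N hN) 1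
    rwa [hζ'] at this
  · intro i
    rw [mapDomain_eq_sum, map_sum]
    conv_rhs => rw [← MonoidAlgebra.sum_coeff_single (u i), Finsupp.sum, Finset.mul_sum,
      Finset.sum_mul]
    refine Finset.sum_congr rfl fun c hc => ?_
    change MonoidAlgebra.mapDomain Φ _ = MonoidAlgebra.single _ 1 * _ * MonoidAlgebra.single _ 1
    rw [MonoidAlgebra.mapDomain_single, hU c (hΩ₁ (hu₁ i c hc)),
      MonoidAlgebra.single_mul_single, MonoidAlgebra.single_mul_single, one_mul, mul_one]
    rfl
  · intro i
    rw [mapDomain_eq_sum, map_sum]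
    conv_rhs => rw [← MonoidAlgebra.sum_coeff_single (v i), Finsupp.sum, Finset.mul_sum]
    refine Finset.sum_congr rfl fun c hc => ?_
    change MonoidAlgebra.mapDomain Φ _ = MonoidAlgebra.single _ 1 * _
    rw [MonoidAlgebra.mapDomain_single, hV _ (hα i) c (hΩ₁ (hv₁ i c hc)),
      MonoidAlgebra.single_mul_single, one_mul]
  · intro i
    refine mapDomain_mem_component f (f.comp Φ) U (huv.left_mem i) fun c hc => ?_
    rw [MonoidHom.comp_apply, hU c (hΩ₁ (hu₁ i c hc))]
    simp only [map_mul, hζ, hζ', one_mul, mul_one]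
  · intro i
    refine mapDomain_mem_component f (f.comp Φ) _ (huv.right_mem i) fun c hc => ?_
    rw [MonoidHom.comp_apply, hV _ (hα i) c (hΩ₁ (hv₁ i c hc)), map_mul, hζ, one_mul]
  -- The encoding of `v i` starts at position `α i`, but `W` does not depend on `i`. The lifted sum
  -- is thus the image of the original one under a single additive map.
  · have h1 : ∀ i, (u i).mapDomain U * (v i).mapDomain (V (α i)) = (u i * v i).mapDomain W := by
      intro i
      refine mapDomain_mul_mapDomain _ _ _ _ _ fun c hc c' hc' => ?_
      have hd := hdegu i c hc
      rw [← hd]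
      exact hUVW c (hΩ₁ (hu₁ i c hc)) c' (hΩ₁ (hv₁ i c' hc'))
        (Finset.mem_union_right _ (Finset.mul_mem_mul (hu₁ i c hc) (hv₁ i c' hc')))
        (hd ▸ hα i)
    simp only [h1]
    let K : MonoidAlgebra D (limitMonoid N hN) →+ MonoidAlgebra D (FreeMonoid (Option Bool)) :=
      ⟨⟨MonoidAlgebra.mapDomain W, MonoidAlgebra.mapDomain_zero W⟩, MonoidAlgebra.mapDomain_add W⟩
    change ∑ i, K (u i * v i) = 0
    rw [← map_sum, huv.sum_eq_zero, map_zero]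

end Cedo

theorem propositionP (D : Type*) [DivisionRing D] (M : Submonoid Cedo.G)
    (hM : M = Cedo.Mlim₀ ∨ M = Cedo.Mlim₁) (h : ℤ × ℤ →+ ℤ) (hh : h ≠ 0) :
    GradedSemifir.IsHomogeneousSemifir
      (GradedSemifir.component D (Cedo.hδ h M)) := by
  rcases hM with rfl | rfl
  · exact Cedo.isHomogeneousSemifir_limitMonoid D _ Cedo.isWordMonoid_M₀ h hh
  · exact Cedo.isHomogeneousSemifir_limitMonoid D _ Cedo.isWordMonoid_M₁ h hh
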